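/- For a real number $p>6$ let $\mathcal S(p)\subset\mathbb H^3$ (curvature $-1$) be the regular truncated tetrahedron with dihedral angles $2\pi/p$: the regular tetrahedron, in the projective model, whose four vertices $B_1,\dots,B_4$ lie outside the absolute and whose six dihedral angles all equal $2\pi/p$, cut off by the polar planes $\beta_1,\dots,\beta_4$ of its vertices. Let $h(p)=\tfrac12 d(\beta_i,\beta_j)$ $(i\neq j)$ be half the common hyperbolic distance of the base planes, let $\mathcal H_i^{h(p)}$ be the hyperball of height $h(p)$ about $\beta_i$, i.e. the set of points at distance at most $h(p)$ from $\beta_i$, and let $$\delta(\mathcal S(p))=\frac{\sum_{i=1}^4\mathrm{Vol}\bigl(\mathcal H_i^{h(p)}\cap\mathcal S(p)\bigr)}{\mathrm{Vol}(\mathcal S(p))}$$ be the locally optimal density of congruent hyperballs in $\mathcal S(p)$. Then for $p\in(6,\infty)$ the density $\delta(\mathcal S(p))$ is a function of the height $h(p)$, that is, $\delta(\mathcal S(p))=D(h(p))$ for some real function $D$, and this function is not increasing, even in the weak sense: there are $p,q>6$ with $h(p)<h(q)$ and $\delta(\mathcal S(p))>\delta(\mathcal S(q))$. -/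

import Mathlib

open MeasureTheory Set

noncomputable section

namespace HyperballPacking

/-! ### The projective model of hyperbolic 3-space (curvature `-1`) -/

/-- The Lorentz form of signature `(1,3)` on `ℝ⁴`. -/
def lorentz (u v : Fin 4 → ℝ) : ℝ :=
  -(u 0 * v 0) + u 1 * v 1 + u 2 * v 2 + u 3 * v 3

/-- The vector `(1, x)` representing the point `x` of the affine chart `x⁰ = 1` of `P³(ℝ)`. -/
def lift (x : EuclideanSpace ℝ (Fin 3)) : Fin 4 → ℝ :=
  ![1, x 0, x 1, x 2]

/-- Hyperbolic 3-space: the interior of the absolute quadric. In the chart `x⁰ = 1` this is the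
open Euclidean unit ball (the Cayley-Klein model). -/
def H3 : Set (EuclideanSpace ℝ (Fin 3)) :=
  {x | lorentz (lift x) (lift x) < 0}

/-- The hyperbolic distance of two points of `H3`:
`cosh d(x, y) = -⟨X, Y⟩ / √(⟨X, X⟩ ⟨Y, Y⟩)`. -/
def hypDist (x y : EuclideanSpace ℝ (Fin 3)) : ℝ :=
  Real.arcosh (-lorentz (lift x) (lift y) /
    Real.sqrt (lorentz (lift x) (lift x) * lorentz (lift y) (lift y)))

/-- The hyperbolic volume measure: in the Cayley-Klein model the volume element is
`dx / (1 - |x|²)²`, and `⟨X, X⟩ = -(1 - |x|²)` for `X = (1, x)`. -/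
def hypVol : Measure (EuclideanSpace ℝ (Fin 3)) :=
  (volume.restrict H3).withDensity
    (fun x => ENNReal.ofReal (1 / (lorentz (lift x) (lift x)) ^ 2))

/-- The hyperbolic plane with pole `u`: the points of `H3` conjugate to the outer point `u`. -/
def polarPlane (u : Fin 4 → ℝ) : Set (EuclideanSpace ℝ (Fin 3)) :=
  {x | x ∈ H3 ∧ lorentz u (lift x) = 0}

/-- The distance of the point `x` from the plane with pole `u`. -/
def distToPlane (x : EuclideanSpace ℝ (Fin 3)) (u : Fin 4 → ℝ) : ℝ :=
  sInf ((fun y => hypDist x y) '' polarPlane u)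

/-- The distance of the planes with poles `u` and `v`. -/
def planeDist (u v : Fin 4 → ℝ) : ℝ :=
  sInf (image2 hypDist (polarPlane u) (polarPlane v))

/-- The hyperball of height `h` about the plane with pole `u`. -/
def hyperball (u : Fin 4 → ℝ) (h : ℝ) : Set (EuclideanSpace ℝ (Fin 3)) :=
  {x | x ∈ H3 ∧ distToPlane x u ≤ h}

/-- The dihedral angle of the wedge `{x | 0 ≤ ⟨u, X⟩ ∧ 0 ≤ ⟨v, X⟩}` bounded by the planes with
poles `u` and `v`. -/
def dihedralAngle (u v : Fin 4 → ℝ) : ℝ :=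
  Real.arccos (-lorentz u v / Real.sqrt (lorentz u u * lorentz v v))

/-! ### The regular truncated tetrahedron -/

/-- Four alternate vertices of the cube `[-1,1]³`: the vertices of a regular tetrahedron centred
at the origin. -/
def tetra : Fin 4 → Fin 3 → ℝ :=
  ![![1, 1, 1], ![1, -1, -1], ![-1, 1, -1], ![-1, -1, 1]]

/-- The scale for which the tetrahedron with vertices `scale p • tetra i` has hyperbolic dihedral
angles `2π/p` (see `dihedralAngle_facePole`). -/
def scale (p : ℝ) : ℝ :=
  Real.sqrt ((3 * Real.cos (2 * Real.pi / p) - 1) / (1 + Real.cos (2 * Real.pi / p)))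

/-- The outer vertex `Bᵢ`. Its polar plane is the base plane `βᵢ`. -/
def outerVertex (p : ℝ) (i : Fin 4) : Fin 4 → ℝ :=
  ![1, scale p * tetra i 0, scale p * tetra i 1, scale p * tetra i 2]

/-- The pole of the face plane opposite `Bᵢ`, i.e. the plane through the other three outer
vertices; `⟨facePole p i, X⟩ ≥ 0` is the half-space that contains the tetrahedron. -/
def facePole (p : ℝ) (i : Fin 4) : Fin 4 → ℝ :=
  ![-scale p, tetra i 0, tetra i 1, tetra i 2]

/-- The regular truncated tetrahedron `S(p)`: the tetrahedron with outer vertices `B₀, …, B₃`,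
cut off by the polar planes of its vertices. -/
def truncTetra (p : ℝ) : Set (EuclideanSpace ℝ (Fin 3)) :=
  {x | x ∈ H3 ∧ (∀ i, 0 ≤ lorentz (facePole p i) (lift x)) ∧
    ∀ i, lorentz (outerVertex p i) (lift x) ≤ 0}

/-- The height `h(p)`: half the distance between two base planes. (All six distances agree; the
infimum over the pairs avoids choosing one of them.) -/
def height (p : ℝ) : ℝ :=
  (⨅ q : {q : Fin 4 × Fin 4 // q.1 ≠ q.2},
    planeDist (outerVertex p q.1.1) (outerVertex p q.1.2)) / 2

/-- The locally optimal density `δ(S(p))`: the total volume of the parts in `S(p)` of the four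
hyperballs of height `h(p)` about the base planes, divided by the volume of `S(p)`. -/
def density (p : ℝ) : ℝ :=
  (∑ i, hypVol.real (hyperball (outerVertex p i) (height p) ∩ truncTetra p)) /
    hypVol.real (truncTetra p)

/-! ### Consistency of the definitions -/

theorem half_lt_cos {p : ℝ} (hp : 6 < p) : 1 / 2 < Real.cos (2 * Real.pi / p) := by
  rw [← Real.cos_pi_div_three]
  have hpi := Real.pi_pos
  apply Real.cos_lt_cos_of_nonneg_of_le_pi
  · positivity
  · linarith
  · rw [div_lt_div_iff₀ (by linarith) (by norm_num)]
    nlinarith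

theorem cos_lt_one {p : ℝ} (hp : 6 < p) : Real.cos (2 * Real.pi / p) < 1 := by
  have hpi := Real.pi_pos
  rw [← Real.cos_zero]
  apply Real.cos_lt_cos_of_nonneg_of_le_pi le_rfl
  · rw [div_le_iff₀ (by linarith)]
    nlinarith
  · positivity

theorem scale_sq {p : ℝ} (hp : 6 < p) : scale p ^ 2 =
    (3 * Real.cos (2 * Real.pi / p) - 1) / (1 + Real.cos (2 * Real.pi / p)) := by
  have h := half_lt_cos hp
  exact Real.sq_sqrt (div_nonneg (by linarith) (by linarith))

theorem scale_bounds {p : ℝ} (hp : 6 < p) :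
    0 < scale p ∧ 1 < 3 * scale p ^ 2 ∧ scale p ^ 2 < 1 := by
  have h := half_lt_cos hp
  have h' := cos_lt_one hp
  refine ⟨Real.sqrt_pos.2 (div_pos (by linarith) (by linarith)), ?_, ?_⟩
  · rw [scale_sq hp, ← mul_div_assoc, lt_div_iff₀ (by linarith)]
    linarith
  · rw [scale_sq hp, div_lt_one (by linarith)]
    linarith

/-- The outer vertices are outer points. -/
theorem lorentz_outerVertex_pos {p : ℝ} (hp : 6 < p) (i : Fin 4) :
    0 < lorentz (outerVertex p i) (outerVertex p i) := by
  have h := scale_bounds hp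
  fin_cases i <;> simp [lorentz, outerVertex, tetra] <;> nlinarith

/-- The plane with pole `facePole p i` passes through the three outer vertices other than `Bᵢ`;
equivalently, it is orthogonal to their base planes. -/
theorem lorentz_facePole_outerVertex (p : ℝ) {i j : Fin 4} (hij : i ≠ j) :
    lorentz (facePole p i) (outerVertex p j) = 0 := by
  fin_cases i <;> fin_cases j <;> first | exact absurd rfl hij | skip
  all_goals simp [lorentz, outerVertex, facePole, tetra]

/-- `Bᵢ` lies in the chosen half-space of the opposite face. -/
theorem lorentz_facePole_outerVertex_self {p : ℝ} (hp : 6 < p) (i : Fin 4) :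
    0 < lorentz (facePole p i) (outerVertex p i) := by
  have h := (scale_bounds hp).1
  fin_cases i <;> simp [lorentz, outerVertex, facePole, tetra] <;> linarith

/-- The six dihedral angles of `S(p)` at the edges of the tetrahedron are `2π/p`. -/
theorem dihedralAngle_facePole {p : ℝ} (hp : 6 < p) {i j : Fin 4} (hij : i ≠ j) :
    dihedralAngle (facePole p i) (facePole p j) = 2 * Real.pi / p := by
  have hb := scale_bounds hp
  have hc := half_lt_cos hp
  have hpi := Real.pi_pos
  have h1 : ∀ k, lorentz (facePole p k) (facePole p k) = 3 - scale p ^ 2 := by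
    intro k
    fin_cases k <;> simp [lorentz, facePole, tetra] <;> ring
  have h2 : lorentz (facePole p i) (facePole p j) = -(1 + scale p ^ 2) := by
    fin_cases i <;> fin_cases j <;> first | exact absurd rfl hij | skip
    all_goals simp [lorentz, facePole, tetra]
    all_goals ring
  rw [dihedralAngle, h1, h1, h2, Real.sqrt_mul_self (by linarith), neg_neg]
  have h3 : (1 + scale p ^ 2) / (3 - scale p ^ 2) = Real.cos (2 * Real.pi / p) := by
    rw [div_eq_iff (by linarith), scale_sq hp]
    field_simp
    ring
  rw [h3, Real.arccos_cos (by positivity)]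
  rw [div_le_iff₀ (by linarith)]
  nlinarith

theorem mem_H3_iff (x : EuclideanSpace ℝ (Fin 3)) :
    x ∈ H3 ↔ x 0 ^ 2 + x 1 ^ 2 + x 2 ^ 2 < 1 := by
  simp [H3, lorentz, lift]
  constructor <;> intro h <;> nlinarith

theorem lorentz_facePole_lift (p : ℝ) (i : Fin 4) (x : EuclideanSpace ℝ (Fin 3)) :
    lorentz (facePole p i) (lift x) =
      scale p + (tetra i 0 * x 0 + tetra i 1 * x 1 + tetra i 2 * x 2) := by
  simp [lorentz, facePole, lift]
  ring

theorem lorentz_outerVertex_lift (p : ℝ) (i : Fin 4) (x : EuclideanSpace ℝ (Fin 3)) :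
    lorentz (outerVertex p i) (lift x) =
      scale p * (tetra i 0 * x 0 + tetra i 1 * x 1 + tetra i 2 * x 2) - 1 := by
  simp [lorentz, outerVertex, lift]
  ring

/-- The eight half-spaces alone cut out a subset of `H3`: the polyhedron `S(p)` has no ideal or
outer points. -/
theorem truncTetra_eq {p : ℝ} (hp : 6 < p) : truncTetra p =
    {x | (∀ i, 0 ≤ lorentz (facePole p i) (lift x)) ∧
      ∀ i, lorentz (outerVertex p i) (lift x) ≤ 0} := by
  ext x
  refine ⟨fun h => h.2, fun h => ⟨?_, h⟩⟩
  obtain ⟨h1, h2⟩ := h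
  obtain ⟨hs, hs1, hs2⟩ := scale_bounds hp
  simp only [lorentz_facePole_lift, lorentz_outerVertex_lift] at h1 h2
  rw [mem_H3_iff]
  by_contra! hx
  have hy : ∀ i, 0 ≤ (scale p + (tetra i 0 * x 0 + tetra i 1 * x 1 + tetra i 2 * x 2)) *
      (1 - scale p * (tetra i 0 * x 0 + tetra i 1 * x 1 + tetra i 2 * x 2)) :=
    fun i => mul_nonneg (h1 i) (by linarith [h2 i])
  have a0 := hy 0
  have a1 := hy 1
  have a2 := hy 2
  have a3 := hy 3
  simp [tetra] at a0 a1 a2 a3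
  generalize scale p = s at *
  generalize x 0 = a at *
  generalize x 1 = b at *
  generalize x 2 = c at *
  have hsx : s * 1 ≤ s * (a ^ 2 + b ^ 2 + c ^ 2) := mul_le_mul_of_nonneg_left hx hs.le
  have e0 : (s + (a + b + c)) * (1 - s * (a + b + c)) = 0 :=
    le_antisymm (by nlinarith only [hsx, a1, a2, a3]) a0
  have e1 : (s + (a + -b + -c)) * (1 - s * (a + -b + -c)) = 0 :=
    le_antisymm (by nlinarith only [hsx, a0, a2, a3]) a1
  have e2 : (s + (-a + b + -c)) * (1 - s * (-a + b + -c)) = 0 :=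
    le_antisymm (by nlinarith only [hsx, a0, a1, a3]) a2
  have e3 : (s + (-a + -b + c)) * (1 - s * (-a + -b + c)) = 0 :=
    le_antisymm (by nlinarith only [hsx, a0, a1, a2]) a3
  have key : ∀ y, (s + y) * (1 - s * y) = 0 → s * y = -s ^ 2 ∨ s * y = 1 := by
    intro y h
    rcases mul_eq_zero.1 h with h | h
    · left
      rw [show y = -s by linarith]
      ring
    · right
      linarith
  rcases key _ e0 with k0 | k0 <;> rcases key _ e1 with k1 | k1 <;>
    rcases key _ e2 with k2 | k2 <;> rcases key _ e3 with k3 | k3 <;> nlinarith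

theorem continuous_lorentz_lift (u : Fin 4 → ℝ) : Continuous fun x => lorentz u (lift x) := by
  simp only [lorentz, lift]
  simp
  fun_prop

theorem continuous_lorentz_lift_self : Continuous fun x => lorentz (lift x) (lift x) := by
  simp only [lorentz, lift]
  simp
  fun_prop

theorem isCompact_truncTetra {p : ℝ} (hp : 6 < p) : IsCompact (truncTetra p) := by
  apply Metric.isCompact_of_isClosed_isBounded
  · rw [truncTetra_eq hp, ofPred_and, ofPred_forall, ofPred_forall]
    exact (isClosed_iInter fun i => isClosed_le continuous_const (continuous_lorentz_lift _)).inter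
      (isClosed_iInter fun i => isClosed_le (continuous_lorentz_lift _) continuous_const)
  · refine (Metric.isBounded_closedBall (x := 0) (r := 1)).subset fun x hx => ?_
    have h := (mem_H3_iff x).1 hx.1
    rw [mem_closedBall_zero_iff, EuclideanSpace.norm_eq, Real.sqrt_le_iff]
    refine ⟨zero_le_one, ?_⟩
    simp [Fin.sum_univ_three]
    exact h.le

/-- `S(p)` has finite volume. -/
theorem hypVol_truncTetra_lt_top {p : ℝ} (hp : 6 < p) : hypVol (truncTetra p) < ⊤ := by
  have hK := isCompact_truncTetra hp
  have hcont : ContinuousOn (fun x => 1 / (lorentz (lift x) (lift x)) ^ 2) (truncTetra p) :=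
    continuousOn_const.div (continuous_lorentz_lift_self.pow 2).continuousOn
      fun x hx => pow_ne_zero 2 (ne_of_lt hx.1)
  obtain ⟨C, hC⟩ := hK.bddAbove_image hcont
  rw [hypVol, withDensity_apply _ hK.measurableSet, Measure.restrict_restrict hK.measurableSet,
    inter_eq_left.2 (fun x hx => hx.1)]
  calc _ ≤ ∫⁻ _ in truncTetra p, ENNReal.ofReal C :=
        setLIntegral_mono' hK.measurableSet fun x hx =>
          ENNReal.ofReal_le_ofReal (hC (mem_image_of_mem _ hx))
    _ < ⊤ := by
        rw [setLIntegral_const]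
        exact ENNReal.mul_lt_top ENNReal.ofReal_lt_top hK.measure_lt_top

/-- `S(p)` has positive volume. -/
theorem hypVol_truncTetra_pos {p : ℝ} (hp : 6 < p) : 0 < hypVol (truncTetra p) := by
  have hK := isCompact_truncTetra hp
  rw [hypVol, withDensity_apply _ hK.measurableSet, Measure.restrict_restrict hK.measurableSet,
    inter_eq_left.2 (fun x hx => hx.1)]
  rw [setLIntegral_pos_iff (by
    have := continuous_lorentz_lift_self.measurable
    fun_prop)]
  let U : Set (EuclideanSpace ℝ (Fin 3)) := {x | x ∈ H3 ∧
    (∀ i, 0 < lorentz (facePole p i) (lift x)) ∧ ∀ i, lorentz (outerVertex p i) (lift x) < 0}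
  have hU : IsOpen U := by
    simp only [U, ofPred_and, ofPred_forall]
    exact (isOpen_lt continuous_lorentz_lift_self continuous_const).inter
      ((isOpen_iInter_of_finite fun i =>
        isOpen_lt continuous_const (continuous_lorentz_lift _)).inter
      (isOpen_iInter_of_finite fun i => isOpen_lt (continuous_lorentz_lift _) continuous_const))
  have hne : U.Nonempty := by
    refine ⟨0, ?_, fun i => ?_, fun i => ?_⟩
    · rw [mem_H3_iff]
      simp
    · rw [lorentz_facePole_lift]
      simpa using (scale_bounds hp).1
    · rw [lorentz_outerVertex_lift]
      simp
  refine (hU.measure_pos volume hne).trans_le (measure_mono fun x hx => ?_)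
  refine ⟨?_, hx.1, fun i => (hx.2.1 i).le, fun i => (hx.2.2 i).le⟩
  have h : lorentz (lift x) (lift x) ≠ 0 := ne_of_lt hx.1
  rw [Function.mem_support, ne_eq, ENNReal.ofReal_eq_zero, not_le]
  positivity

end HyperballPacking

end

noncomputable section

namespace HyperballPacking

/-! ### Distances between points and planes -/

/-! The family is governed by the single parameter `κ = 1 - 1/(3s²)`, where `s = scale p`. It runs
over the whole interval `(0, 2/3)`, and `κ → 0` means `p → 6` and height tending to infinity. Since
`cosh 2h = (1 + s²)/(3s² - 1)`, the height decreases in `s`, hence in `κ`. So the density is a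
function of the height, and it suffices to find `κ' < κ` with smaller density at `κ'`. They exist
because the density climbs with infinite slope away from its limit at `κ = 0`.

To see this, cut `S(p)` into four congruent sectors by the bisectors of the base planes. No
hyperball crosses its bisectors (`le_of_mem_ballRegion`), so the density is that of one ball in one
sector (`density_eq`). The projective map `chart` sends `B₀` to infinity: the perpendiculars to the
base plane become parallel fibres over a triangle that does not depend on `κ`, and the volume
element becomes a constant times `1 / quad²` (`hypVol_image_chart`). On each fibre the ball is the
end segment next to the base plane `κ v = 1`.

The ball part of a fibre is integrated exactly (`lintegral_ball_fibre`). It is at least `1/3 - κ/2 +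
(κ/4) log(2/(3κ))` by `ballFactor_lower`, and it tends to `1/3`. The gap between bisector and ball
is a positive limit up to an error `O(κ)` (`toReal_chartVol_gap_bounds`). If the density never rose
with `κ`, comparison with the limit `κ' → 0` would bound the `κ log(1/κ)` gain of the ball by
`O(κ)`, which fails for small `κ` (`exists_kappaDensity_lt`). -/

theorem lorentz_comm (u v : Fin 4 → ℝ) : lorentz u v = lorentz v u := by
  simp only [lorentz]
  ring

theorem lorentz_sub_smul (u w v : Fin 4 → ℝ) (c : ℝ) :
    lorentz (u - c • w) v = lorentz u v - c * lorentz w v := by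
  simp [lorentz]
  ring

theorem lorentz_smul (u v : Fin 4 → ℝ) (c : ℝ) : lorentz (c • u) v = c * lorentz u v := by
  simp [lorentz]
  ring

theorem lorentz_smul_right (u v : Fin 4 → ℝ) (c : ℝ) : lorentz u (c • v) = c * lorentz u v := by
  simp [lorentz]
  ring

theorem apply_zero_ne_zero_of_lorentz_neg {u : Fin 4 → ℝ} (hu : lorentz u u < 0) : u 0 ≠ 0 := by
  intro h
  simp only [lorentz, h] at hu
  nlinarith [sq_nonneg (u 1), sq_nonneg (u 2), sq_nonneg (u 3)]

/-- The combination `u₀ v - v₀ u` has no time component, so its Lorentz square is nonnegative;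
expand it. -/
theorem lorentz_sq_add_le (u v : Fin 4 → ℝ) :
    u 0 ^ 2 * -lorentz v v + v 0 ^ 2 * -lorentz u u ≤ 2 * (u 0 * v 0) * -lorentz u v := by
  simp only [lorentz]
  nlinarith [sq_nonneg (u 0 * v 1 - v 0 * u 1), sq_nonneg (u 0 * v 2 - v 0 * u 2),
    sq_nonneg (u 0 * v 3 - v 0 * u 3)]

/-- The reverse Cauchy-Schwarz inequality for timelike vectors. -/
theorem lorentz_mul_le_sq {u v : Fin 4 → ℝ} (hu : lorentz u u < 0) (hv : lorentz v v < 0) :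
    lorentz u u * lorentz v v ≤ lorentz u v ^ 2 := by
  have h0 := apply_zero_ne_zero_of_lorentz_neg hu
  have h1 := apply_zero_ne_zero_of_lorentz_neg hv
  have h := lorentz_sq_add_le u v
  have hpos : 0 < (u 0 * v 0) ^ 2 := by positivity
  generalize lorentz u v = C at *
  generalize lorentz u u = A at *
  generalize lorentz v v = B at *
  -- Squaring the inequality `h` and using `4xy ≤ (x + y)²` leaves the common factor `(u₀ v₀)²`,
  -- which is then cancelled.
  have h2 : 0 ≤ u 0 ^ 2 * -B + v 0 ^ 2 * -A :=
    add_nonneg (mul_nonneg (sq_nonneg _) (by linarith)) (mul_nonneg (sq_nonneg _) (by linarith))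
  have h3 := pow_le_pow_left₀ h2 h 2
  have h4 : (u 0 * v 0) ^ 2 * (A * B) ≤ (u 0 * v 0) ^ 2 * C ^ 2 := by
    nlinarith [sq_nonneg (u 0 ^ 2 * -B - v 0 ^ 2 * -A)]
  exact le_of_mul_le_mul_left h4 hpos

theorem lorentz_lift_neg {x y : EuclideanSpace ℝ (Fin 3)} (hx : x ∈ H3) (hy : y ∈ H3) :
    lorentz (lift x) (lift y) < 0 := by
  have h := lorentz_sq_add_le (lift x) (lift y)
  have h1 : lorentz (lift x) (lift x) < 0 := hx
  have h2 : lorentz (lift y) (lift y) < 0 := hy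
  have h3 : ∀ z, lift z 0 = 1 := fun z => rfl
  rw [h3, h3] at h
  linarith

/-- Squaring the numerator makes the expression invariant under rescaling either vector, including
by negative factors. Feet of perpendiculars may therefore be used without normalising them. -/
theorem hypDist_eq {x y : EuclideanSpace ℝ (Fin 3)} (hx : x ∈ H3) (hy : y ∈ H3) :
    hypDist x y = Real.arcosh (Real.sqrt (lorentz (lift x) (lift y) ^ 2 /
      (lorentz (lift x) (lift x) * lorentz (lift y) (lift y)))) := by
  rw [hypDist, Real.sqrt_div (sq_nonneg _), ← neg_sq,
    Real.sqrt_sq (by linarith [lorentz_lift_neg hx hy])]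

/-- The point of the affine chart represented by a vector. -/
def toPoint (u : Fin 4 → ℝ) : EuclideanSpace ℝ (Fin 3) :=
  !₂[(u 0)⁻¹ * u 1, (u 0)⁻¹ * u 2, (u 0)⁻¹ * u 3]

theorem lift_toPoint {u : Fin 4 → ℝ} (hu : u 0 ≠ 0) : lift (toPoint u) = (u 0)⁻¹ • u := by
  ext i
  fin_cases i <;> simp [lift, toPoint, hu]

theorem toPoint_mem_H3 {u : Fin 4 → ℝ} (hu : lorentz u u < 0) : toPoint u ∈ H3 := by
  have h0 := apply_zero_ne_zero_of_lorentz_neg hu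
  rw [H3, mem_ofPred_eq, lift_toPoint h0, lorentz_smul, lorentz_smul_right]
  have : 0 < (u 0)⁻¹ * (u 0)⁻¹ := mul_self_pos.2 (inv_ne_zero h0)
  nlinarith

theorem arcosh_sqrt_le_arcosh_sqrt {a b : ℝ} (ha : 0 < a) (hb : 0 < b) :
    Real.arcosh (Real.sqrt a) ≤ Real.arcosh (Real.sqrt b) ↔ a ≤ b := by
  rw [Real.arcosh_le_arcosh (Real.sqrt_pos.2 ha) (Real.sqrt_pos.2 hb), Real.sqrt_le_sqrt_iff hb.le]

/-- The distance of a point from a plane is attained at the orthogonal projection. -/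
theorem isLeast_hypDist_polarPlane {u : Fin 4 → ℝ} (hu : 0 < lorentz u u)
    {x : EuclideanSpace ℝ (Fin 3)} (hx : x ∈ H3) :
    IsLeast ((fun y => hypDist x y) '' polarPlane u)
      (Real.arcosh (Real.sqrt (1 + lorentz u (lift x) ^ 2 /
        (lorentz u u * -lorentz (lift x) (lift x))))) := by
  have hX : lorentz (lift x) (lift x) < 0 := hx
  set X := lift x with hXdef
  -- The foot of the perpendicular from `x`, as the Lorentz projection of `X` to the complement of
  -- `u`.
  set Z := X - (lorentz u X / lorentz u u) • u with hZ
  have e1 : ∀ w, lorentz Z w = lorentz X w - lorentz u X / lorentz u u * lorentz u w :=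
    fun w => lorentz_sub_smul _ _ _ _
  have e2 : lorentz Z u = 0 := by
    rw [e1, lorentz_comm X u]
    field_simp
    ring
  have e3 : lorentz Z X = lorentz X X - lorentz u X ^ 2 / lorentz u u := by
    rw [e1]
    ring
  have e4 : lorentz Z Z = lorentz X X - lorentz u X ^ 2 / lorentz u u := by
    rw [e1, lorentz_comm u Z, e2, lorentz_comm X Z, e3]
    ring
  have e5 : 0 ≤ lorentz u X ^ 2 / lorentz u u := by positivity
  have hZn : lorentz Z Z < 0 := by linarith
  have e6 : 1 + lorentz u X ^ 2 / (lorentz u u * -lorentz X X) = lorentz Z Z / lorentz X X := by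
    have := hX.ne
    rw [e4]
    field_simp
    ring
  have h0 := apply_zero_ne_zero_of_lorentz_neg hZn
  rw [e6]
  constructor
  · refine ⟨toPoint Z, ⟨toPoint_mem_H3 hZn, ?_⟩, ?_⟩
    · rw [lift_toPoint h0, lorentz_smul_right, lorentz_comm, e2, mul_zero]
    · simp only
      rw [hypDist_eq hx (toPoint_mem_H3 hZn), lift_toPoint h0, ← hXdef]
      simp only [lorentz_smul_right, lorentz_smul]
      rw [lorentz_comm X Z, e3, ← e4]
      congr 2
      have := hX.ne
      have := hZn.ne
      field_simp
  · rintro _ ⟨y, ⟨hy, hyu⟩, rfl⟩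
    have hY : lorentz (lift y) (lift y) < 0 := hy
    simp only
    -- On the plane, `X` and its projection `Z` pair equally with `Y`, so the reverse Cauchy-Schwarz
    -- inequality for `Z` and `Y` gives the lower bound.
    have h1 : lorentz Z (lift y) = lorentz X (lift y) := by
      rw [e1, hyu]
      ring
    have h2 := lorentz_mul_le_sq hZn hY
    rw [h1] at h2
    have h3 := lorentz_lift_neg hx hy
    rw [hypDist_eq hx hy, arcosh_sqrt_le_arcosh_sqrt (div_pos_of_neg_of_neg hZn hX)
      (div_pos (sq_pos_of_neg h3) (mul_pos_of_neg_of_neg hX hY)), ← hXdef,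
      le_div_iff₀ (mul_pos_of_neg_of_neg hX hY)]
    calc lorentz Z Z / lorentz X X * (lorentz X X * lorentz (lift y) (lift y))
        = lorentz Z Z * lorentz (lift y) (lift y) := by
          have := hX.ne
          field_simp
      _ ≤ _ := h2

theorem distToPlane_eq {u : Fin 4 → ℝ} (hu : 0 < lorentz u u)
    {x : EuclideanSpace ℝ (Fin 3)} (hx : x ∈ H3) :
    distToPlane x u = Real.arcosh (Real.sqrt (1 + lorentz u (lift x) ^ 2 /
        (lorentz u u * -lorentz (lift x) (lift x)))) :=
  (isLeast_hypDist_polarPlane hu hx).csInf_eq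

/-- The distance of two ultraparallel planes is attained on their common perpendicular. -/
theorem planeDist_eq {u v : Fin 4 → ℝ} (hu : 0 < lorentz u u) (hv : 0 < lorentz v v)
    (huv : lorentz u u * lorentz v v < lorentz u v ^ 2) :
    planeDist u v =
      Real.arcosh (Real.sqrt (lorentz u v ^ 2 / (lorentz u u * lorentz v v))) := by
  -- The projection of `v` to the complement of `u`. It is timelike exactly because the planes are
  -- ultraparallel, and it represents the foot of the common perpendicular on the first plane.
  set Z := v - (lorentz u v / lorentz u u) • u with hZ
  have e1 : ∀ w, lorentz Z w = lorentz v w - lorentz u v / lorentz u u * lorentz u w :=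
    fun w => lorentz_sub_smul _ _ _ _
  have e2 : lorentz u Z = 0 := by
    rw [lorentz_comm, e1, lorentz_comm v u]
    field_simp
    ring
  have e3 : lorentz v Z = lorentz v v - lorentz u v ^ 2 / lorentz u u := by
    rw [lorentz_comm, e1]
    ring
  have e4 : lorentz Z Z = lorentz v v - lorentz u v ^ 2 / lorentz u u := by
    rw [e1, e2, e3]
    ring
  have hZn : lorentz Z Z < 0 := by
    rw [e4, sub_neg, lt_div_iff₀ hu]
    linarith
  have e6 : lorentz u v ^ 2 / (lorentz u u * lorentz v v) = 1 + -lorentz Z Z / lorentz v v := by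
    rw [e4]
    field_simp
    ring
  have h0 := apply_zero_ne_zero_of_lorentz_neg hZn
  rw [e6]
  refine IsLeast.csInf_eq ⟨?_, ?_⟩
  · have hx := toPoint_mem_H3 hZn
    obtain ⟨y, hy, hxy⟩ := (isLeast_hypDist_polarPlane hv hx).1
    refine ⟨toPoint Z, ⟨hx, ?_⟩, y, hy, ?_⟩
    · rw [lift_toPoint h0, lorentz_smul_right, e2, mul_zero]
    · simp only at hxy
      rw [hxy, lift_toPoint h0]
      simp only [lorentz_smul_right, lorentz_smul]
      rw [e3, ← e4]
      congr 3
      have := hZn.ne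
      field_simp
  · rintro _ ⟨x, ⟨hx, hxu⟩, y, hy, rfl⟩
    have hX : lorentz (lift x) (lift x) < 0 := hx
    refine le_trans ?_ ((isLeast_hypDist_polarPlane hv hx).2 ⟨y, hy, rfl⟩)
    have h1 : lorentz Z (lift x) = lorentz v (lift x) := by
      rw [e1, hxu]
      ring
    have h2 := lorentz_mul_le_sq hZn hX
    rw [h1] at h2
    have h3 : 0 < lorentz v v * -lorentz (lift x) (lift x) := mul_pos hv (by linarith)
    rw [arcosh_sqrt_le_arcosh_sqrt]
    · rw [add_le_add_iff_left, div_le_div_iff₀ hv h3]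
      nlinarith
    · have : 0 < -lorentz Z Z / lorentz v v := div_pos (by linarith) hv
      linarith
    · have : 0 ≤ lorentz v (lift x) ^ 2 / (lorentz v v * -lorentz (lift x) (lift x)) :=
        div_nonneg (sq_nonneg _) h3.le
      linarith

/-! ### The height -/

theorem lorentz_outerVertex_self (p : ℝ) (i : Fin 4) :
    lorentz (outerVertex p i) (outerVertex p i) = 3 * scale p ^ 2 - 1 := by
  fin_cases i <;> simp [lorentz, outerVertex, tetra] <;> ring

theorem lorentz_outerVertex (p : ℝ) {i j : Fin 4} (hij : i ≠ j) :
    lorentz (outerVertex p i) (outerVertex p j) = -(1 + scale p ^ 2) := by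
  fin_cases i <;> fin_cases j <;> first | exact absurd rfl hij | skip
  all_goals simp [lorentz, outerVertex, tetra]
  all_goals ring

theorem height_eq {p : ℝ} (hp : 6 < p) :
    height p = Real.arcosh ((1 + scale p ^ 2) / (3 * scale p ^ 2 - 1)) / 2 := by
  obtain ⟨hs, hs1, hs2⟩ := scale_bounds hp
  have : Nonempty {q : Fin 4 × Fin 4 // q.1 ≠ q.2} := ⟨⟨(0, 1), by simp⟩⟩
  rw [height]
  congr 1
  rw [← ciInf_const (ι := {q : Fin 4 × Fin 4 // q.1 ≠ q.2})
    (a := Real.arcosh ((1 + scale p ^ 2) / (3 * scale p ^ 2 - 1)))]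
  congr 1
  ext ⟨q, hq⟩
  have h1 : 0 < 3 * scale p ^ 2 - 1 := by linarith
  rw [planeDist_eq] <;>
    simp only [lorentz_outerVertex_self, lorentz_outerVertex p hq]
  · rw [neg_sq, ← sq, ← div_pow, Real.sqrt_sq (by positivity)]
  · exact h1
  · exact h1
  · nlinarith

theorem one_lt_cosh_two_height {p : ℝ} (hp : 6 < p) :
    1 < (1 + scale p ^ 2) / (3 * scale p ^ 2 - 1) := by
  obtain ⟨hs, hs1, hs2⟩ := scale_bounds hp
  rw [lt_div_iff₀ (by linarith)]
  linarith

/-- The quantity `cosh 2h = (1 + s²)/(3s² - 1)` is strictly decreasing in `s²`. -/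
theorem height_lt_height_iff {p q : ℝ} (hp : 6 < p) (hq : 6 < q) :
    height p < height q ↔ scale q < scale p := by
  obtain ⟨hs, hs1, hs2⟩ := scale_bounds hp
  obtain ⟨ht, ht1, ht2⟩ := scale_bounds hq
  have h1 := one_lt_cosh_two_height hp
  have h2 := one_lt_cosh_two_height hq
  rw [height_eq hp, height_eq hq, div_lt_div_iff_of_pos_right two_pos,
    Real.arcosh_lt_arcosh (by linarith) (by linarith),
    div_lt_div_iff₀ (by linarith) (by linarith), ← pow_lt_pow_iff_left₀ ht.le hs.le two_ne_zero]
  constructor <;> intro h <;> nlinarith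

theorem height_pos {p : ℝ} (hp : 6 < p) : 0 < height p := by
  rw [height_eq hp]
  have := Real.arcosh_pos (one_lt_cosh_two_height hp)
  positivity

theorem cosh_height_sq {p : ℝ} (hp : 6 < p) :
    Real.cosh (height p) ^ 2 = 1 + (1 - scale p ^ 2) / (3 * scale p ^ 2 - 1) := by
  obtain ⟨hs, hs1, hs2⟩ := scale_bounds hp
  have h : Real.cosh (2 * height p) = (1 + scale p ^ 2) / (3 * scale p ^ 2 - 1) := by
    rw [height_eq hp, mul_div_cancel₀ _ two_ne_zero,
      Real.cosh_arcosh (one_lt_cosh_two_height hp).le]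
  rw [Real.cosh_two_mul, Real.sinh_sq] at h
  have h1 : 3 * scale p ^ 2 - 1 ≠ 0 := by linarith
  have h2 : Real.cosh (height p) ^ 2 =
      ((1 + scale p ^ 2) / (3 * scale p ^ 2 - 1) + 1) / 2 := by linarith
  rw [h2, div_add_one h1, one_add_div h1]
  ring

/-- Both sides of `sinh² d ≤ sinh² h` have the denominator `⟨B, B⟩ = 3s² - 1`, which cancels and
leaves a quadratic condition. -/
theorem mem_hyperball_height_iff {p : ℝ} (hp : 6 < p) (i : Fin 4)
    {x : EuclideanSpace ℝ (Fin 3)} (hx : x ∈ H3) :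
    x ∈ hyperball (outerVertex p i) (height p) ↔
      lorentz (outerVertex p i) (lift x) ^ 2 ≤
        (1 - scale p ^ 2) * -lorentz (lift x) (lift x) := by
  obtain ⟨hs, hs1, hs2⟩ := scale_bounds hp
  have h1 : 0 < 3 * scale p ^ 2 - 1 := by linarith
  have hX : 0 < -lorentz (lift x) (lift x) := neg_pos.2 hx
  have hh := height_pos hp
  have h2 : 0 ≤ lorentz (outerVertex p i) (lift x) ^ 2 /
        ((3 * scale p ^ 2 - 1) * -lorentz (lift x) (lift x)) := by positivity
  rw [hyperball, mem_ofPred_eq, and_iff_right hx, distToPlane_eq (lorentz_outerVertex_pos hp i) hx,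
    lorentz_outerVertex_self]
  nth_rw 1 [← Real.arcosh_cosh hh.le]
  rw [← Real.sqrt_sq (Real.cosh_pos (height p)).le, cosh_height_sq hp,
    arcosh_sqrt_le_arcosh_sqrt (by positivity), add_le_add_iff_left,
    div_le_div_iff₀ (by positivity) h1]
  · rw [mul_comm (3 * scale p ^ 2 - 1), ← mul_assoc, mul_le_mul_iff_left₀ h1]
  · have : 0 < 1 - scale p ^ 2 := by linarith
    positivity

/-! ### The projective chart centred at an outer vertex -/

theorem hypVol_apply {A : Set (EuclideanSpace ℝ (Fin 3))} (hA : MeasurableSet A) (hA3 : A ⊆ H3) :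
    hypVol A = ∫⁻ x in A, ENNReal.ofReal (1 / (lorentz (lift x) (lift x)) ^ 2) := by
  rw [hypVol, withDensity_apply _ hA, Measure.restrict_restrict hA, inter_eq_left.2 hA3]

/-- `1 + |z|²` in barycentric coordinates of the base triangle. -/
def shape (a b : ℝ) : ℝ := 1 + (a ^ 2 + b ^ 2 + (a + b) ^ 2) / 3

/-- The equation of the absolute in the projective chart. -/
def quad (κ a b v : ℝ) : ℝ := 2 * v - κ * v ^ 2 - shape a b

/-- The parameter `κ = 1 - 1 / (3 s²)`. -/
def kappa (s : ℝ) : ℝ := 1 - 1 / (3 * s ^ 2)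

/-- The projective chart that sends the outer vertex `s (1, 1, 1)` to infinity. -/
def chart (s : ℝ) (y : Fin 3 → ℝ) : Fin 3 → ℝ :=
  ![s * (1 + (y 1 - 1) / y 0), s * (1 + (y 2 - 1) / y 0), s * (1 - (y 1 + y 2 + 1) / y 0)]

/-- The Jacobian matrix of `chart`. -/
def chartJacobian (s : ℝ) (y : Fin 3 → ℝ) : Matrix (Fin 3) (Fin 3) ℝ :=
  !![-(s * (y 1 - 1) / y 0 ^ 2), s / y 0, 0;
     -(s * (y 2 - 1) / y 0 ^ 2), 0, s / y 0;
     s * (y 1 + y 2 + 1) / y 0 ^ 2, -(s / y 0), -(s / y 0)]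

theorem det_chartJacobian (s : ℝ) {y : Fin 3 → ℝ} (hy : 0 < y 0) :
    (chartJacobian s y).det = 3 * s ^ 3 / y 0 ^ 4 := by
  rw [Matrix.det_fin_three]
  simp [chartJacobian]
  field_simp
  ring

theorem hasFDerivAt_chart (s : ℝ) {y : Fin 3 → ℝ} (hy : 0 < y 0) :
    HasFDerivAt (chart s) (Matrix.toLin' (chartJacobian s y)).toContinuousLinearMap y := by
  have h : ∀ i, HasFDerivAt (fun y : Fin 3 → ℝ => y i)
    (ContinuousLinearMap.proj (R := ℝ) (φ := fun _ : Fin 3 => ℝ) i) y := fun i =>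
      hasFDerivAt_apply i y
  have hinv := (hasDerivAt_inv hy.ne').comp_hasFDerivAt y (h 0)
  refine hasFDerivAt_pi'' fun i => ?_
  fin_cases i
  · refine ((((h 1).sub_const 1).mul hinv).const_mul s |>.const_add s |>.congr_fderiv
      ?_).congr_of_eventuallyEq (Filter.Eventually.of_forall fun z => ?_)
    · ext w
      simp [chartJacobian, dotProduct, Fin.sum_univ_three]
      field_simp
    · simp [chart]
      ring
  · refine ((((h 2).sub_const 1).mul hinv).const_mul s |>.const_add s |>.congr_fderiv
      ?_).congr_of_eventuallyEq (Filter.Eventually.of_forall fun z => ?_)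
    · ext w
      simp [chartJacobian, dotProduct, Fin.sum_univ_three]
      field_simp
    · simp [chart]
      ring
  · refine (((((h 1).add (h 2)).add_const 1).mul hinv).const_mul (-s) |>.const_add s |>.congr_fderiv
      ?_).congr_of_eventuallyEq (Filter.Eventually.of_forall fun z => ?_)
    · ext w
      simp [chartJacobian, dotProduct, Fin.sum_univ_three]
      field_simp
      ring
    · simp [chart]
      ring

theorem injOn_chart {s : ℝ} (hs : 0 < s) : InjOn (chart s) {y | 0 < y 0} := by
  intro y hy z hz h
  have hy' : 0 < y 0 := hy
  have hz' : 0 < z 0 := hz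
  have e0 := congrFun h 0
  have e1 := congrFun h 1
  have e2 := congrFun h 2
  simp only [chart, Matrix.cons_val] at e0 e1 e2
  have f0 := mul_left_cancel₀ hs.ne' e0
  have f1 := mul_left_cancel₀ hs.ne' e1
  have f2 := mul_left_cancel₀ hs.ne' e2
  -- The sum of the three affine coordinates is `3s(1 - 1/y₀)`, so it determines `y₀`.
  have f3 : 3 / y 0 = 3 / z 0 := by
    have : (y 1 - 1) / y 0 + (y 2 - 1) / y 0 - (y 1 + y 2 + 1) / y 0 =
      (z 1 - 1) / z 0 + (z 2 - 1) / z 0 - (z 1 + z 2 + 1) / z 0 := by linarith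
    have e : ∀ v a b : ℝ, (a - 1) / v + (b - 1) / v - (a + b + 1) / v = -(3 / v) := by
      intro v a b
      ring
    rw [e, e] at this
    linarith
  have g0 : y 0 = z 0 := by
    rw [div_eq_div_iff hy'.ne' hz'.ne'] at f3
    linarith
  rw [g0, add_right_inj, div_left_inj' hz'.ne'] at f0 f1
  ext i
  fin_cases i
  · exact g0
  · simpa using f0
  · simpa using f1

theorem lorentz_lift_chart {s : ℝ} (hs : 0 < s) {y : Fin 3 → ℝ} (hy : 0 < y 0) :
    lorentz (lift (WithLp.toLp 2 (chart s y))) (lift (WithLp.toLp 2 (chart s y))) =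
      -(3 * s ^ 2 * quad (kappa s) (y 1) (y 2) (y 0) / y 0 ^ 2) := by
  simp [lorentz, lift, chart, quad, kappa, shape]
  field_simp
  ring

theorem continuousOn_chart (s : ℝ) : ContinuousOn (chart s) {y | 0 < y 0} := fun _ hy =>
  (hasFDerivAt_chart s hy).continuousAt.continuousWithinAt

theorem measurableSet_image_chart {s : ℝ} (hs : 0 < s) {E : Set (Fin 3 → ℝ)}
    (hE : MeasurableSet E) (hE0 : E ⊆ {y | 0 < y 0}) : MeasurableSet (chart s '' E) :=
  hE.image_of_continuousOn_injOn ((continuousOn_chart s).mono hE0) ((injOn_chart hs).mono hE0)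

/-- The hyperbolic volume in the projective chart. -/
theorem hypVol_image_chart {s : ℝ} (hs : 0 < s) {E : Set (Fin 3 → ℝ)}
    (hE : MeasurableSet E) (hE0 : E ⊆ {y | 0 < y 0})
    (hE3 : WithLp.toLp 2 '' (chart s '' E) ⊆ H3) :
    hypVol (WithLp.toLp 2 '' (chart s '' E)) = ENNReal.ofReal (1 / (3 * s)) *
      ∫⁻ y in E, ENNReal.ofReal (1 / quad (kappa s) (y 1) (y 2) (y 0) ^ 2) := by
  have hemb : MeasurableEmbedding (WithLp.toLp 2 : (Fin 3 → ℝ) → EuclideanSpace ℝ (Fin 3)) :=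
    (MeasurableEquiv.toLp 2 (Fin 3 → ℝ)).measurableEmbedding
  rw [hypVol_apply (hemb.measurableSet_image.2 (measurableSet_image_chart hs hE hE0)) hE3,
    ← (PiLp.volume_preserving_toLp (Fin 3)).setLIntegral_comp_emb hemb,
    lintegral_image_eq_lintegral_abs_det_fderiv_mul volume hE
      (fun y hy => (hasFDerivAt_chart s (hE0 hy)).hasFDerivWithinAt) ((injOn_chart hs).mono hE0),
    ← lintegral_const_mul' _ _ ENNReal.ofReal_ne_top]
  refine setLIntegral_congr_fun hE fun y hy => ?_
  have hy0 : 0 < y 0 := hE0 hy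
  have hdet : (Matrix.toLin' (chartJacobian s y)).toContinuousLinearMap.det =
      3 * s ^ 3 / y 0 ^ 4 := by
    rw [ContinuousLinearMap.det, LinearMap.coe_toContinuousLinearMap, LinearMap.det_toLin',
      det_chartJacobian s hy0]
  rw [hdet, lorentz_lift_chart hs hy0, abs_of_pos (by positivity),
    ← ENNReal.ofReal_mul (by positivity), ← ENNReal.ofReal_mul (by positivity)]
  -- The factor `y₀⁻⁴` of the Jacobian cancels against the one in the squared Lorentz form, leaving
  -- the constant `1/(3s)`.
  congr 1
  rcases eq_or_ne (quad (kappa s) (y 1) (y 2) (y 0)) 0 with h | h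
  · simp [h]
  · field_simp

/-! ### The decomposition of `S(p)` into four congruent sectors -/

/-- The part of `S(p)` nearest to the outer vertex `Bᵢ`. -/
def sector (p : ℝ) (i : Fin 4) : Set (EuclideanSpace ℝ (Fin 3)) :=
  {x | x ∈ truncTetra p ∧
    ∀ j, lorentz (outerVertex p j) (lift x) ≤ lorentz (outerVertex p i) (lift x)}

/-- The sector of `B₀` in the projective chart. -/
def prism (κ : ℝ) : Set (Fin 3 → ℝ) :=
  {y | (-1 / 2 ≤ y 1 ∧ -1 / 2 ≤ y 2 ∧ y 1 + y 2 ≤ 1 / 2) ∧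
    1 + y 1 / 2 ≤ y 0 ∧ 1 + y 2 / 2 ≤ y 0 ∧ 1 - (y 1 + y 2) / 2 ≤ y 0 ∧ κ * y 0 ≤ 1}

theorem kappa_bounds {p : ℝ} (hp : 6 < p) : 0 < kappa (scale p) ∧ kappa (scale p) < 2 / 3 := by
  obtain ⟨hs, hs1, hs2⟩ := scale_bounds hp
  have h3 : 0 < 3 * scale p ^ 2 := by positivity
  constructor
  · rw [kappa, sub_pos, div_lt_one h3]
    exact hs1
  · have : 1 / 3 < 1 / (3 * scale p ^ 2) := one_div_lt_one_div_of_lt h3 (by linarith)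
    rw [kappa]
    linarith

theorem prism_subset (κ : ℝ) : prism κ ⊆ {y | 0 < y 0} := by
  rintro y ⟨⟨h1, h2, h3⟩, h4, h5, h6, h7⟩
  simp only [mem_ofPred_eq]
  linarith

theorem measurableSet_prism (κ : ℝ) : MeasurableSet (prism κ) := by
  apply IsClosed.measurableSet
  simp only [prism, ofPred_and]
  refine ((isClosed_le ?_ ?_).inter ((isClosed_le ?_ ?_).inter (isClosed_le ?_ ?_))).inter
    ((isClosed_le ?_ ?_).inter ((isClosed_le ?_ ?_).inter
      ((isClosed_le ?_ ?_).inter (isClosed_le ?_ ?_)))) <;> fun_prop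

/-- The part of the chart that represents the hyperball about the base plane of `B₀`. -/
def ballRegion (κ : ℝ) : Set (Fin 3 → ℝ) :=
  {y | (1 - κ * y 0) ^ 2 ≤ (2 / 3 - κ) * quad κ (y 1) (y 2) (y 0)}

theorem measurableSet_ballRegion (κ : ℝ) : MeasurableSet (ballRegion κ) := by
  apply IsClosed.measurableSet
  simp only [ballRegion, quad, shape]
  refine isClosed_le ?_ ?_ <;> fun_prop

/-- The chart covers the half-space on the origin's side of the plane through `B₀` parallel to its
polar plane; that plane itself goes to infinity. -/
theorem exists_chart_eq {s : ℝ} (hs : 0 < s) {x : EuclideanSpace ℝ (Fin 3)}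
    (hx : x 0 + x 1 + x 2 < 3 * s) : ∃ y : Fin 3 → ℝ, 0 < y 0 ∧ WithLp.toLp 2 (chart s y) = x := by
  obtain ⟨v, hv, hx2⟩ : ∃ v : ℝ, 0 < v ∧ x 2 = 3 * s - 3 * s / v - x 0 - x 1 := by
    have hd : 0 < 3 * s - (x 0 + x 1 + x 2) := by linarith
    refine ⟨3 * s / (3 * s - (x 0 + x 1 + x 2)), by positivity, ?_⟩
    rw [div_div_cancel₀ (by positivity)]
    ring
  refine ⟨![v, 1 + v * (x 0 / s - 1), 1 + v * (x 1 / s - 1)], hv, ?_⟩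
  ext i
  fin_cases i <;> simp [chart] <;> try rw [hx2]
  all_goals
    field_simp
    ring

/-! ### Faces, bisectors and hyperball in chart coordinates -/

section Chart

variable {p : ℝ} {y : Fin 3 → ℝ}

theorem facePole_chart (hy : 0 < y 0) :
    lorentz (facePole p 1) (lift (WithLp.toLp 2 (chart (scale p) y))) =
        scale p * ((1 + 2 * y 1) / y 0) ∧
      lorentz (facePole p 2) (lift (WithLp.toLp 2 (chart (scale p) y))) =
        scale p * ((1 + 2 * y 2) / y 0) ∧
      lorentz (facePole p 3) (lift (WithLp.toLp 2 (chart (scale p) y))) =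
        scale p * ((1 - 2 * (y 1 + y 2)) / y 0) ∧
      lorentz (facePole p 0) (lift (WithLp.toLp 2 (chart (scale p) y))) =
        scale p * ((4 * y 0 - 3) / y 0) := by
  refine ⟨?_, ?_, ?_, ?_⟩ <;> rw [lorentz_facePole_lift] <;> simp [tetra, chart] <;> field_simp <;>
    ring

theorem outerVertex_sub_chart (hy : 0 < y 0) :
    lorentz (outerVertex p 0) (lift (WithLp.toLp 2 (chart (scale p) y))) -
      lorentz (outerVertex p 1) (lift (WithLp.toLp 2 (chart (scale p) y))) =
        4 * scale p ^ 2 * ((y 0 - (1 + y 1 / 2)) / y 0) ∧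
    lorentz (outerVertex p 0) (lift (WithLp.toLp 2 (chart (scale p) y))) -
      lorentz (outerVertex p 2) (lift (WithLp.toLp 2 (chart (scale p) y))) =
        4 * scale p ^ 2 * ((y 0 - (1 + y 2 / 2)) / y 0) ∧
    lorentz (outerVertex p 0) (lift (WithLp.toLp 2 (chart (scale p) y))) -
      lorentz (outerVertex p 3) (lift (WithLp.toLp 2 (chart (scale p) y))) =
        4 * scale p ^ 2 * ((y 0 - (1 - (y 1 + y 2) / 2)) / y 0) := by
  refine ⟨?_, ?_, ?_⟩ <;> simp only [lorentz_outerVertex_lift] <;> simp [tetra, chart] <;>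
    field_simp <;> ring

theorem outerVertex_zero_chart (hp : 6 < p) (hy : 0 < y 0) :
    lorentz (outerVertex p 0) (lift (WithLp.toLp 2 (chart (scale p) y))) =
      -(3 * scale p ^ 2 * ((1 - kappa (scale p) * y 0) / y 0)) := by
  have hs := (scale_bounds hp).1
  rw [lorentz_outerVertex_lift]
  simp [tetra, chart, kappa]
  field_simp
  ring

theorem chart_mem_truncTetra (hp : 6 < p) (hy : 0 < y 0)
    (h : WithLp.toLp 2 (chart (scale p) y) ∈ truncTetra p) :
    -1 / 2 ≤ y 1 ∧ -1 / 2 ≤ y 2 ∧ y 1 + y 2 ≤ 1 / 2 ∧ kappa (scale p) * y 0 ≤ 1 := by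
  obtain ⟨hs, hs1, hs2⟩ := scale_bounds hp
  obtain ⟨e1, e2, e3, -⟩ := facePole_chart (p := p) hy
  obtain ⟨-, h1, h2⟩ := h
  have f1 := h1 1
  have f2 := h1 2
  have f3 := h1 3
  have f0 := h2 0
  rw [e1, mul_nonneg_iff_of_pos_left hs, le_div_iff₀ hy] at f1
  rw [e2, mul_nonneg_iff_of_pos_left hs, le_div_iff₀ hy] at f2
  rw [e3, mul_nonneg_iff_of_pos_left hs, le_div_iff₀ hy] at f3
  rw [outerVertex_zero_chart hp hy, neg_nonpos, mul_nonneg_iff_of_pos_left (by positivity),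
    le_div_iff₀ hy] at f0
  refine ⟨?_, ?_, ?_, ?_⟩ <;> linarith

theorem chart_mem_sector_iff (hp : 6 < p) (hy : 0 < y 0) :
    WithLp.toLp 2 (chart (scale p) y) ∈ sector p 0 ↔ y ∈ prism (kappa (scale p)) := by
  obtain ⟨hs, hs1, hs2⟩ := scale_bounds hp
  have hs4 : 0 < 4 * scale p ^ 2 := by positivity
  obtain ⟨e1, e2, e3, e0⟩ := facePole_chart (p := p) hy
  obtain ⟨d1, d2, d3⟩ := outerVertex_sub_chart (p := p) hy
  constructor
  · rintro ⟨h, h'⟩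
    obtain ⟨f1, f2, f3, f0⟩ := chart_mem_truncTetra hp hy h
    have g1 := sub_nonneg.2 (h' 1)
    have g2 := sub_nonneg.2 (h' 2)
    have g3 := sub_nonneg.2 (h' 3)
    rw [d1, mul_nonneg_iff_of_pos_left hs4, le_div_iff₀ hy] at g1
    rw [d2, mul_nonneg_iff_of_pos_left hs4, le_div_iff₀ hy] at g2
    rw [d3, mul_nonneg_iff_of_pos_left hs4, le_div_iff₀ hy] at g3
    exact ⟨⟨f1, f2, f3⟩, by linarith, by linarith, by linarith, f0⟩
  · rintro ⟨⟨f1, f2, f3⟩, g1, g2, g3, f0⟩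
    have b0 : lorentz (outerVertex p 0) (lift (WithLp.toLp 2 (chart (scale p) y))) ≤ 0 := by
      rw [outerVertex_zero_chart hp hy, neg_nonpos]
      exact mul_nonneg (by positivity) (div_nonneg (by linarith) hy.le)
    have hb : ∀ j, lorentz (outerVertex p j) (lift (WithLp.toLp 2 (chart (scale p) y))) ≤
        lorentz (outerVertex p 0) (lift (WithLp.toLp 2 (chart (scale p) y))) := by
      intro j
      fin_cases j
      · exact le_rfl
      · refine sub_nonneg.1 (d1.symm ▸ mul_nonneg hs4.le (div_nonneg (by linarith) hy.le))
      · refine sub_nonneg.1 (d2.symm ▸ mul_nonneg hs4.le (div_nonneg (by linarith) hy.le))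
      · refine sub_nonneg.1 (d3.symm ▸ mul_nonneg hs4.le (div_nonneg (by linarith) hy.le))
    refine ⟨?_, hb⟩
    rw [truncTetra_eq hp]
    refine ⟨fun j => ?_, fun j => (hb j).trans b0⟩
    fin_cases j
    -- The face opposite `B₀` imposes nothing on the sector: the three bisector inequalities add up
    -- to `y₀ ≥ 1`.
    · exact e0.symm ▸ mul_nonneg hs.le (div_nonneg (by linarith) hy.le)
    · exact e1.symm ▸ mul_nonneg hs.le (div_nonneg (by linarith) hy.le)
    · exact e2.symm ▸ mul_nonneg hs.le (div_nonneg (by linarith) hy.le)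
    · exact e3.symm ▸ mul_nonneg hs.le (div_nonneg (by linarith) hy.le)

theorem chart_mem_hyperball_iff (hp : 6 < p) (hy : 0 < y 0)
    (hx : WithLp.toLp 2 (chart (scale p) y) ∈ H3) :
    WithLp.toLp 2 (chart (scale p) y) ∈ hyperball (outerVertex p 0) (height p) ↔
      y ∈ ballRegion (kappa (scale p)) := by
  obtain ⟨hs, hs1, hs2⟩ := scale_bounds hp
  rw [mem_hyperball_height_iff hp 0 hx, outerVertex_zero_chart hp hy, lorentz_lift_chart hs hy,
    ballRegion, mem_ofPred_eq, neg_neg, neg_sq]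
  have e1 : (3 * scale p ^ 2 * ((1 - kappa (scale p) * y 0) / y 0)) ^ 2 =
      (9 * scale p ^ 4 / y 0 ^ 2) * (1 - kappa (scale p) * y 0) ^ 2 := by
    field_simp
    ring
  have e2 : (1 - scale p ^ 2) * (3 * scale p ^ 2 * quad (kappa (scale p)) (y 1) (y 2) (y 0) /
        y 0 ^ 2) = (9 * scale p ^ 4 / y 0 ^ 2) *
        ((2 / 3 - kappa (scale p)) * quad (kappa (scale p)) (y 1) (y 2) (y 0)) := by
    have : 2 / 3 - kappa (scale p) = (1 - scale p ^ 2) / (3 * scale p ^ 2) := by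
      rw [kappa]
      field_simp
      ring
    rw [this]
    field_simp
    ring
  rw [e1, e2, mul_le_mul_iff_right₀ (by positivity)]

end Chart

theorem sum_lt_of_mem_truncTetra {p : ℝ} (hp : 6 < p) {x : EuclideanSpace ℝ (Fin 3)}
    (hx : x ∈ truncTetra p) : x 0 + x 1 + x 2 < 3 * scale p := by
  obtain ⟨hs, hs1, hs2⟩ := scale_bounds hp
  have h := hx.2.2 0
  rw [lorentz_outerVertex_lift] at h
  simp [tetra] at h
  nlinarith

theorem sector_eq_image {p : ℝ} (hp : 6 < p) :
    sector p 0 = WithLp.toLp 2 '' (chart (scale p) '' prism (kappa (scale p))) := by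
  ext x
  constructor
  · intro hx
    obtain ⟨y, hy, rfl⟩ := exists_chart_eq (scale_bounds hp).1 (sum_lt_of_mem_truncTetra hp hx.1)
    exact ⟨_, ⟨y, (chart_mem_sector_iff hp hy).1 hx, rfl⟩, rfl⟩
  · rintro ⟨_, ⟨y, hy, rfl⟩, rfl⟩
    exact (chart_mem_sector_iff hp (prism_subset _ hy)).2 hy

theorem sector_inter_hyperball_eq_image {p : ℝ} (hp : 6 < p) :
    sector p 0 ∩ hyperball (outerVertex p 0) (height p) = WithLp.toLp 2 ''
      (chart (scale p) '' (prism (kappa (scale p)) ∩ ballRegion (kappa (scale p)))) := by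
  ext x
  constructor
  · rintro ⟨hx, hx'⟩
    obtain ⟨y, hy, rfl⟩ := exists_chart_eq (scale_bounds hp).1 (sum_lt_of_mem_truncTetra hp hx.1)
    exact ⟨_, ⟨y, ⟨(chart_mem_sector_iff hp hy).1 hx,
      (chart_mem_hyperball_iff hp hy hx.1.1).1 hx'⟩, rfl⟩, rfl⟩
  · rintro ⟨_, ⟨y, ⟨hy, hy'⟩, rfl⟩, rfl⟩
    have h0 := prism_subset _ hy
    have h1 := (chart_mem_sector_iff hp h0).2 hy
    exact ⟨h1, (chart_mem_hyperball_iff hp h0 h1.1.1).2 hy'⟩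

/-- A point below the bisector plane is not in the hyperball. -/
theorem le_of_mem_ballRegion {κ D m v : ℝ} (hκ : 0 < κ) (hκ' : κ < 2 / 3) (hm : m ≤ 1)
    (hD : 1 + m ^ 2 / 2 ≤ D)
    (h : (1 - κ * v) ^ 2 ≤ (2 / 3 - κ) * (2 * v - κ * v ^ 2 - D)) : 1 + m / 2 ≤ v := by
  -- The difference of the two sides of `h`, with `D` replaced by `1 + m²/2`, is strictly increasing
  -- in `v` below the bisector. At `v = 1 + m/2` it equals `-(1 - κ)(1 - m)²/3`. Equality at `m = 1`
  -- reflects that two hyperballs touch at the midpoint of an edge.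
  by_contra! hlt
  have h1 : (1 - κ * v) ^ 2 ≤ (2 / 3 - κ) * (2 * v - κ * v ^ 2 - (1 + m ^ 2 / 2)) :=
    h.trans (mul_le_mul_of_nonneg_left (by linarith) (by linarith))
  have h2 : κ * (v + (1 + m / 2)) < 2 := by nlinarith
  have h3 : 0 < (1 + m / 2 - v) * (4 / 3 - 2 / 3 * (κ * (v + (1 + m / 2)))) :=
    mul_pos (by linarith) (by linarith)
  have h4 : 0 ≤ (1 - κ) * (1 - m) ^ 2 := mul_nonneg (by linarith) (sq_nonneg _)
  nlinarith

/-- The numbers `y₁`, `y₂`, `-(y₁ + y₂)` are shifted barycentric coordinates with sum zero. If one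
of them is `m`, their squares sum to at least `3m²/2`, which is the hypothesis on `D` in
`le_of_mem_ballRegion` for each of the three bisectors. -/
theorem hyperball_inter_truncTetra_subset_zero {p : ℝ} (hp : 6 < p) :
    hyperball (outerVertex p 0) (height p) ∩ truncTetra p ⊆ sector p 0 := by
  rintro x ⟨hx, hx'⟩
  obtain ⟨y, hy, rfl⟩ := exists_chart_eq (scale_bounds hp).1 (sum_lt_of_mem_truncTetra hp hx')
  rw [chart_mem_sector_iff hp hy]
  obtain ⟨h1, h2, h3, h4⟩ := chart_mem_truncTetra hp hy hx'
  have hb := (chart_mem_hyperball_iff hp hy hx'.1).1 hx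
  obtain ⟨hκ, hκ'⟩ := kappa_bounds hp
  refine ⟨⟨h1, h2, h3⟩, ?_, ?_, ?_, h4⟩
  · refine le_of_mem_ballRegion hκ hκ' (by linarith) ?_ hb
    rw [shape]
    nlinarith [sq_nonneg (y 1 + 2 * y 2)]
  · refine le_of_mem_ballRegion hκ hκ' (by linarith) ?_ hb
    rw [shape]
    nlinarith [sq_nonneg (2 * y 1 + y 2)]
  · have := le_of_mem_ballRegion hκ hκ' (m := -(y 1 + y 2)) (by linarith) (by
      rw [shape]
      nlinarith [sq_nonneg (y 1 - y 2)]) hb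
    linarith

/-! ### Symmetry -/

/-- The sign change that maps `tetra 0` to `tetra i`. -/
def flip (i : Fin 4) : EuclideanSpace ℝ (Fin 3) ≃ₗᵢ[ℝ] EuclideanSpace ℝ (Fin 3) :=
  LinearIsometryEquiv.piLpCongrRight 2 fun k =>
    if 0 < tetra i k then LinearIsometryEquiv.refl ℝ ℝ else LinearIsometryEquiv.neg ℝ

theorem flip_apply (i : Fin 4) (x : EuclideanSpace ℝ (Fin 3)) (k : Fin 3) :
    flip i x k = tetra i k * x k := by
  have h : ¬ (1 : ℝ) < 0 := by norm_num
  fin_cases i <;> fin_cases k <;> simp [flip, tetra, h]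

/-- The rows of `tetra` form a Klein four-group under coordinatewise multiplication, and the
numbering is chosen so that the product is bitwise exclusive or of the indices. -/
theorem tetra_mul (i j : Fin 4) (k : Fin 3) : tetra j k * tetra i k = tetra (i ^^^ j) k := by
  fin_cases i <;> fin_cases j <;> fin_cases k <;> simp [tetra]

theorem lorentz_facePole_flip (p : ℝ) (i j : Fin 4) (x : EuclideanSpace ℝ (Fin 3)) :
    lorentz (facePole p j) (lift (flip i x)) = lorentz (facePole p (i ^^^ j)) (lift x) := by
  simp only [lorentz_facePole_lift, flip_apply, ← mul_assoc, tetra_mul]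

theorem lorentz_outerVertex_flip (p : ℝ) (i j : Fin 4) (x : EuclideanSpace ℝ (Fin 3)) :
    lorentz (outerVertex p j) (lift (flip i x)) = lorentz (outerVertex p (i ^^^ j)) (lift x) := by
  simp only [lorentz_outerVertex_lift, flip_apply, ← mul_assoc, tetra_mul]

theorem lorentz_flip_self (i : Fin 4) (x : EuclideanSpace ℝ (Fin 3)) :
    lorentz (lift (flip i x)) (lift (flip i x)) = lorentz (lift x) (lift x) := by
  fin_cases i <;> simp [lorentz, lift, flip_apply, tetra]

theorem flip_mem_H3 (i : Fin 4) (x : EuclideanSpace ℝ (Fin 3)) : flip i x ∈ H3 ↔ x ∈ H3 := by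
  simp only [H3, mem_ofPred_eq, lorentz_flip_self]

theorem fin_four_xor_xor : ∀ i j : Fin 4, i ^^^ (i ^^^ j) = j := by decide

theorem fin_four_xor_zero : ∀ i : Fin 4, i ^^^ 0 = i := by decide

theorem forall_xor_iff (i : Fin 4) (P : Fin 4 → Prop) : (∀ j, P (i ^^^ j)) ↔ ∀ j, P j :=
  ⟨fun h j => by simpa only [fin_four_xor_xor] using h (i ^^^ j), fun h j => h _⟩

theorem flip_mem_truncTetra (p : ℝ) (i : Fin 4) (x : EuclideanSpace ℝ (Fin 3)) :
    flip i x ∈ truncTetra p ↔ x ∈ truncTetra p := by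
  simp only [truncTetra, mem_ofPred_eq, flip_mem_H3, lorentz_facePole_flip,
    lorentz_outerVertex_flip]
  rw [forall_xor_iff i fun j => 0 ≤ lorentz (facePole p j) (lift x),
    forall_xor_iff i fun j => lorentz (outerVertex p j) (lift x) ≤ 0]

theorem flip_mem_sector (p : ℝ) (i : Fin 4) (x : EuclideanSpace ℝ (Fin 3)) :
    flip i x ∈ sector p 0 ↔ x ∈ sector p i := by
  simp only [sector, mem_ofPred_eq, flip_mem_truncTetra, lorentz_outerVertex_flip,
    fin_four_xor_zero]
  rw [forall_xor_iff i fun j => lorentz (outerVertex p j) (lift x) ≤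
    lorentz (outerVertex p i) (lift x)]

theorem flip_mem_hyperball {p : ℝ} (hp : 6 < p) (i : Fin 4) (x : EuclideanSpace ℝ (Fin 3)) :
    flip i x ∈ hyperball (outerVertex p 0) (height p) ↔
      x ∈ hyperball (outerVertex p i) (height p) := by
  by_cases hx : x ∈ H3
  · rw [mem_hyperball_height_iff hp _ hx, mem_hyperball_height_iff hp _ ((flip_mem_H3 i x).2 hx),
      lorentz_outerVertex_flip, lorentz_flip_self, fin_four_xor_zero]
  · exact iff_of_false (fun h => hx ((flip_mem_H3 i x).1 h.1)) fun h => hx h.1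

theorem hypVol_preimage_flip (i : Fin 4) {A : Set (EuclideanSpace ℝ (Fin 3))}
    (hA : MeasurableSet A) (hA3 : A ⊆ H3) : hypVol (flip i ⁻¹' A) = hypVol A := by
  have hm : Measurable (flip i) := (flip i).continuous.measurable
  rw [hypVol_apply hA hA3, hypVol_apply (hm hA) fun x hx => (flip_mem_H3 i x).1 (hA3 hx),
    ← (flip i).measurePreserving.setLIntegral_comp_preimage hA]
  · simp only [lorentz_flip_self]
  · have := continuous_lorentz_lift_self.measurable
    fun_prop

/-! ### Reduction to one sector -/

theorem measurableSet_sector {p : ℝ} (hp : 6 < p) (i : Fin 4) : MeasurableSet (sector p i) := by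
  have h := (isCompact_truncTetra hp).isClosed
  apply IsClosed.measurableSet
  rw [sector, ofPred_and, ofPred_forall]
  exact h.inter (isClosed_iInter fun j =>
    isClosed_le (continuous_lorentz_lift _) (continuous_lorentz_lift _))

theorem measurableSet_sector_inter_hyperball {p : ℝ} (hp : 6 < p) :
    MeasurableSet (sector p 0 ∩ hyperball (outerVertex p 0) (height p)) := by
  rw [sector_inter_hyperball_eq_image hp]
  have hE := (measurableSet_prism (kappa (scale p))).inter
    (measurableSet_ballRegion (kappa (scale p)))
  exact (MeasurableEquiv.toLp 2 (Fin 3 → ℝ)).measurableEmbedding.measurableSet_image.2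
    (measurableSet_image_chart (scale_bounds hp).1 hE (inter_subset_left.trans (prism_subset _)))

theorem hypVol_sector {p : ℝ} (hp : 6 < p) (i : Fin 4) :
    hypVol (sector p i) = hypVol (sector p 0) := by
  rw [← hypVol_preimage_flip i (measurableSet_sector hp 0) fun x hx => hx.1.1]
  congr 1
  ext x
  rw [mem_preimage, flip_mem_sector]

theorem hypVol_hyperball_inter_truncTetra {p : ℝ} (hp : 6 < p) (i : Fin 4) :
    hypVol (hyperball (outerVertex p i) (height p) ∩ truncTetra p) =
      hypVol (sector p 0 ∩ hyperball (outerVertex p 0) (height p)) := by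
  rw [← hypVol_preimage_flip i (measurableSet_sector_inter_hyperball hp) fun x hx => hx.1.1.1]
  congr 1
  ext x
  simp only [mem_preimage, mem_inter_iff, flip_mem_sector, flip_mem_hyperball hp]
  constructor
  · intro h
    refine ⟨(flip_mem_sector p i x).1 (hyperball_inter_truncTetra_subset_zero hp ⟨?_, ?_⟩), h.1⟩
    · exact (flip_mem_hyperball hp i x).2 h.1
    · exact (flip_mem_truncTetra p i x).2 h.2
  · exact fun h => ⟨h.2, h.1.1⟩

theorem exists_tetra_ne {i j : Fin 4} (hij : i ≠ j) : ∃ k, tetra i k ≠ tetra j k := by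
  by_contra! h
  have h0 := h 0
  have h1 := h 1
  have h2 := h 2
  revert hij
  fin_cases i <;> fin_cases j <;> simp [tetra] at h0 h1 h2 ⊢ <;> linarith

/-- Two sectors meet inside the kernel of a nonzero linear form, and hyperbolic volume is absolutely
continuous with respect to Lebesgue measure. -/
theorem aedisjoint_sector {p : ℝ} (hp : 6 < p) {i j : Fin 4} (hij : i ≠ j) :
    AEDisjoint hypVol (sector p i) (sector p j) := by
  have hac : hypVol ≪ volume :=
    (withDensity_absolutelyContinuous _ _).trans Measure.absolutelyContinuous_restrict
  let f : EuclideanSpace ℝ (Fin 3) →ₗ[ℝ] ℝ :=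
    ∑ k, (tetra i k - tetra j k) • (EuclideanSpace.proj k : _ →L[ℝ] ℝ).toLinearMap
  have hf : ∀ x, f x = ∑ k, (tetra i k - tetra j k) * x k := by
    intro x
    simp [f, LinearMap.sum_apply]
  have hne : LinearMap.ker f ≠ ⊤ := by
    obtain ⟨k, hk⟩ := exists_tetra_ne hij
    intro h
    have : f (EuclideanSpace.single k 1) = 0 := by
      rw [← LinearMap.mem_ker, h]
      trivial
    rw [hf] at this
    simp [sub_eq_zero] at this
    exact hk this
  refine hac (measure_mono_null ?_ (Measure.addHaar_submodule volume _ hne))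
  rintro x ⟨hi, hj⟩
  have h := le_antisymm (hi.2 j) (hj.2 i)
  rw [lorentz_outerVertex_lift, lorentz_outerVertex_lift, sub_left_inj,
    mul_right_inj' (scale_bounds hp).1.ne'] at h
  rw [SetLike.mem_coe, LinearMap.mem_ker, hf, Fin.sum_univ_three]
  linarith

theorem truncTetra_eq_iUnion (p : ℝ) : truncTetra p = ⋃ i ∈ Finset.univ, sector p i := by
  ext x
  simp only [Finset.mem_univ, iUnion_true, mem_iUnion]
  constructor
  · intro hx
    obtain ⟨i, hi⟩ := Finite.exists_max fun j => lorentz (outerVertex p j) (lift x)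
    exact ⟨i, hx, hi⟩
  · rintro ⟨i, hx, -⟩
    exact hx

theorem density_eq {p : ℝ} (hp : 6 < p) :
    density p = hypVol.real (sector p 0 ∩ hyperball (outerVertex p 0) (height p)) /
      hypVol.real (sector p 0) := by
  have h1 : hypVol.real (truncTetra p) = 4 * hypVol.real (sector p 0) := by
    rw [measureReal_def, truncTetra_eq_iUnion, measure_biUnion_finset₀
      (fun i _ j _ hij => aedisjoint_sector hp hij)
      fun i _ => (measurableSet_sector hp i).nullMeasurableSet]
    simp [hypVol_sector hp, measureReal_def]
  rw [density, h1]
  simp only [measureReal_def, hypVol_hyperball_inter_truncTetra hp]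
  rw [Finset.sum_const, Finset.card_univ, Fintype.card_fin, nsmul_eq_mul]
  exact mul_div_mul_left _ _ (by norm_num)

/-- The volume density in the projective chart, up to a constant factor. -/
def chartVol (κ : ℝ) (E : Set (Fin 3 → ℝ)) : ENNReal :=
  ∫⁻ y in E, ENNReal.ofReal (1 / quad κ (y 1) (y 2) (y 0) ^ 2)

theorem density_eq_chartVol {p : ℝ} (hp : 6 < p) :
    density p = (chartVol (kappa (scale p)) (prism (kappa (scale p)) ∩
        ballRegion (kappa (scale p)))).toReal /
      (chartVol (kappa (scale p)) (prism (kappa (scale p)))).toReal := by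
  have hs := (scale_bounds hp).1
  have hE := measurableSet_prism (kappa (scale p))
  have h1 := hypVol_image_chart hs hE (prism_subset _) (by
    rw [← sector_eq_image hp]
    exact fun x hx => hx.1.1)
  have h2 := hypVol_image_chart hs (hE.inter (measurableSet_ballRegion (kappa (scale p))))
    (inter_subset_left.trans (prism_subset _)) (by
    rw [← sector_inter_hyperball_eq_image hp]
    exact fun x hx => hx.1.1.1)
  rw [← sector_eq_image hp] at h1
  rw [← sector_inter_hyperball_eq_image hp] at h2
  rw [density_eq hp, measureReal_def, measureReal_def, h1, h2, ENNReal.toReal_mul,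
    ENNReal.toReal_mul, chartVol, chartVol]
  refine mul_div_mul_left _ _ ?_
  rw [ENNReal.toReal_ofReal (by positivity)]
  positivity

/-! ### Integration along the fibres of the chart -/

/-- The base triangle in the chart. -/
def triangle : Set (Fin 2 → ℝ) := {z | -1 / 2 ≤ z 0 ∧ -1 / 2 ≤ z 1 ∧ z 0 + z 1 ≤ 1 / 2}

/-- The largest barycentric coordinate (minus a constant). -/
def maxCoord (z : Fin 2 → ℝ) : ℝ := max (max (z 0) (z 1)) (-(z 0 + z 1))

theorem lintegral_Icc_of_hasDerivAt {f F : ℝ → ℝ} {a b : ℝ} (hab : a ≤ b)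
    (hF : ∀ x ∈ Icc a b, HasDerivAt F (f x) x) (hf : ContinuousOn f (Icc a b))
    (h0 : ∀ x ∈ Icc a b, 0 ≤ f x) :
    ∫⁻ x in Icc a b, ENNReal.ofReal (f x) = ENNReal.ofReal (F b - F a) := by
  rw [← ofReal_integral_eq_lintegral_ofReal hf.integrableOn_Icc
    ((ae_restrict_iff' measurableSet_Icc).2 (Filter.Eventually.of_forall h0)),
    integral_Icc_eq_integral_Ioc, ← intervalIntegral.integral_of_le hab,
    intervalIntegral.integral_eq_sub_of_hasDerivAt]
  · rwa [uIcc_of_le hab]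
  · apply ContinuousOn.intervalIntegrable
    rwa [uIcc_of_le hab]

/-- Tonelli's theorem, with the fibre variable `v = y 0` integrated first. -/
theorem chartVol_eq_lintegral (κ : ℝ) {E : Set (Fin 3 → ℝ)} (hE : MeasurableSet E)
    {T : Set (Fin 2 → ℝ)} (hT : MeasurableSet T) {I : (Fin 2 → ℝ) → Set ℝ}
    (hI : ∀ z ∈ T, MeasurableSet (I z))
    (h : ∀ y : Fin 3 → ℝ, y ∈ E ↔ (![y 1, y 2] ∈ T ∧ y 0 ∈ I ![y 1, y 2])) :
    chartVol κ E = ∫⁻ z in T, ∫⁻ v in I z, ENNReal.ofReal (1 / quad κ (z 0) (z 1) v ^ 2) := by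
  have hmeas : Measurable fun y : Fin 3 → ℝ =>
      ENNReal.ofReal (1 / quad κ (y 1) (y 2) (y 0) ^ 2) := by
    unfold quad shape
    fun_prop
  have hmp := (volume_preserving_piFinSuccAbove (fun _ : Fin 3 => ℝ) 0).symm
  have hcons : ∀ (v : ℝ) (z : Fin 2 → ℝ),
      (MeasurableEquiv.piFinSuccAbove (fun _ : Fin 3 => ℝ) 0).symm (v, z) = ![v, z 0, z 1] := by
    intro v z
    ext i
    fin_cases i <;> rfl
  rw [chartVol, ← lintegral_indicator hE, ← hmp.lintegral_comp (hmeas.indicator hE),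
    Measure.volume_eq_prod]
  have hswap := lintegral_prod_symm' (μ := (volume : Measure ℝ))
    (ν := (volume : Measure (Fin 2 → ℝ))) _ ((hmeas.indicator hE).comp hmp.measurable)
  simp only [Function.comp_def] at hswap
  rw [hswap, ← lintegral_indicator hT]
  refine lintegral_congr fun z => ?_
  have hz : ![z 0, z 1] = z := by
    ext i
    fin_cases i <;> rfl
  by_cases hzT : z ∈ T
  · rw [indicator_of_mem hzT, ← lintegral_indicator (hI z hzT)]
    refine lintegral_congr fun v => ?_
    have : ![v, z 0, z 1] ∈ E ↔ v ∈ I z := by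
      rw [h]
      simp [hz, hzT]
    rw [hcons]
    by_cases hv : v ∈ I z
    · rw [indicator_of_mem hv, indicator_of_mem (this.2 hv)]
      rfl
    · rw [indicator_of_notMem hv, indicator_of_notMem (fun h' => hv (this.1 h'))]
  · rw [indicator_of_notMem hzT]
    refine lintegral_eq_zero_of_ae_eq_zero (Filter.Eventually.of_forall fun v => ?_)
    simp only [hcons, Pi.zero_apply]
    refine indicator_of_notMem (fun h' => hzT ?_) _
    simpa [hz] using ((h _).1 h').1

theorem isClosed_triangle : IsClosed triangle := by
  simp only [triangle, ofPred_and]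
  refine (isClosed_le ?_ ?_).inter ((isClosed_le ?_ ?_).inter (isClosed_le ?_ ?_)) <;> fun_prop

theorem volume_triangle_lt_top : volume triangle < ⊤ := by
  refine (measure_mono ?_).trans_lt
    (isCompact_Icc (a := fun _ : Fin 2 => (-1 / 2 : ℝ)) (b := fun _ => 1)).measure_lt_top
  rintro z ⟨h1, h2, h3⟩
  refine ⟨fun i => ?_, fun i => ?_⟩ <;> fin_cases i <;> simp <;> linarith

/-- The small square of points near the centre of the triangle. -/
theorem volume_square_pos : 0 < volume (Icc (fun _ : Fin 2 => (-1 / 4 : ℝ)) fun _ => 1 / 4) := by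
  rw [Real.volume_Icc_pi, Fin.prod_univ_two, ← ENNReal.ofReal_mul (by norm_num)]
  exact ENNReal.ofReal_pos.2 (by norm_num)

theorem square_subset_triangle :
    Icc (fun _ : Fin 2 => (-1 / 4 : ℝ)) (fun _ => 1 / 4) ⊆ triangle := by
  rintro z ⟨h1, h2⟩
  have a0 := h1 0
  have a1 := h1 1
  have b0 := h2 0
  have b1 := h2 1
  simp only at a0 a1 b0 b1
  refine ⟨?_, ?_, ?_⟩ <;> linarith

theorem volume_triangle_pos : 0 < volume triangle :=
  volume_square_pos.trans_le (measure_mono square_subset_triangle)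

/-! ### Estimates on the base triangle -/

section Triangle

variable {z : Fin 2 → ℝ}

theorem maxCoord_le_iff {c : ℝ} : maxCoord z ≤ c ↔ z 0 ≤ c ∧ z 1 ≤ c ∧ -(z 0 + z 1) ≤ c := by
  rw [maxCoord, max_le_iff, max_le_iff, and_assoc]

theorem maxCoord_nonneg : 0 ≤ maxCoord z := by
  obtain ⟨h1, h2, h3⟩ := maxCoord_le_iff.1 (le_refl (maxCoord z))
  linarith

theorem maxCoord_le_one (hz : z ∈ triangle) : maxCoord z ≤ 1 := by
  obtain ⟨h1, h2, h3⟩ := hz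
  exact maxCoord_le_iff.2 ⟨by linarith, by linarith, by linarith⟩

/-- Sum `(zᵢ + 1/2)(m - zᵢ) ≥ 0` over the three coordinates, whose total is zero. -/
theorem shape_le (hz : z ∈ triangle) : shape (z 0) (z 1) ≤ 1 + maxCoord z / 2 := by
  obtain ⟨a1, a2, a3⟩ := hz
  obtain ⟨h1, h2, h3⟩ := maxCoord_le_iff.1 (le_refl (maxCoord z))
  have e1 : 0 ≤ (z 0 + 1 / 2) * (maxCoord z - z 0) := mul_nonneg (by linarith) (by linarith)
  have e2 : 0 ≤ (z 1 + 1 / 2) * (maxCoord z - z 1) := mul_nonneg (by linarith) (by linarith)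
  have e3 : 0 ≤ (-(z 0 + z 1) + 1 / 2) * (maxCoord z - -(z 0 + z 1)) :=
    mul_nonneg (by linarith) (by linarith)
  rw [shape]
  nlinarith

theorem le_shape : 1 + maxCoord z ^ 2 / 2 ≤ shape (z 0) (z 1) := by
  have h : maxCoord z = z 0 ∨ maxCoord z = z 1 ∨ maxCoord z = -(z 0 + z 1) := by
    rw [maxCoord]
    rcases max_choice (max (z 0) (z 1)) (-(z 0 + z 1)) with h | h
    · rw [h]
      rcases max_choice (z 0) (z 1) with h | h <;> simp [h]
    · exact Or.inr (Or.inr h)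
  rw [shape]
  rcases h with h | h | h <;> rw [h]
  · nlinarith [sq_nonneg (z 0 + 2 * z 1)]
  · nlinarith [sq_nonneg (2 * z 0 + z 1)]
  · nlinarith [sq_nonneg (z 0 - z 1)]

end Triangle

/-- The hyperbolic tangent of the height. -/
def tanhHeight (κ : ℝ) : ℝ := Real.sqrt (1 - 3 * κ / 2)

/-- The half-chord of the fibre over a point of the triangle. -/
def halfChord (κ : ℝ) (z : Fin 2 → ℝ) : ℝ := Real.sqrt (1 - κ * shape (z 0) (z 1))

/-- The end of the fibre of the hyperball. -/
def ballEnd (κ : ℝ) (z : Fin 2 → ℝ) : ℝ := (1 - tanhHeight κ * halfChord κ z) / κ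

/-! ### Fibres of the sector and of the hyperball -/

section Fibre

variable {κ : ℝ} {z : Fin 2 → ℝ}

theorem mem_prism_iff (y : Fin 3 → ℝ) : y ∈ prism κ ↔ ![y 1, y 2] ∈ triangle ∧
    1 + maxCoord ![y 1, y 2] / 2 ≤ y 0 ∧ κ * y 0 ≤ 1 := by
  have h : 1 + maxCoord ![y 1, y 2] / 2 ≤ y 0 ↔ maxCoord ![y 1, y 2] ≤ 2 * (y 0 - 1) := by
    constructor <;> intro h <;> linarith
  rw [h, maxCoord_le_iff]
  simp only [prism, triangle, mem_ofPred_eq, Matrix.cons_val]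
  refine and_congr_right fun _ => ?_
  constructor
  · rintro ⟨h1, h2, h3, h4⟩
    exact ⟨⟨by linarith, by linarith, by linarith⟩, h4⟩
  · rintro ⟨⟨h1, h2, h3⟩, h4⟩
    exact ⟨by linarith, by linarith, by linarith, h4⟩

theorem tanhHeight_sq (hκ : κ < 2 / 3) : tanhHeight κ ^ 2 = 1 - 3 * κ / 2 :=
  Real.sq_sqrt (by linarith)

theorem tanhHeight_pos (hκ : κ < 2 / 3) : 0 < tanhHeight κ := Real.sqrt_pos.2 (by linarith)

theorem shape_mul_lt_one (hκ : 0 < κ) (hκ' : κ < 2 / 3) (hz : z ∈ triangle) :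
    κ * shape (z 0) (z 1) ≤ 3 * κ / 2 ∧ κ * shape (z 0) (z 1) < 1 := by
  have h1 := shape_le hz
  have h2 := maxCoord_le_one hz
  constructor <;> nlinarith

theorem halfChord_sq (hκ : 0 < κ) (hκ' : κ < 2 / 3) (hz : z ∈ triangle) :
    halfChord κ z ^ 2 = 1 - κ * shape (z 0) (z 1) :=
  Real.sq_sqrt (by linarith [(shape_mul_lt_one hκ hκ' hz).2])

theorem halfChord_pos (hκ : 0 < κ) (hκ' : κ < 2 / 3) (hz : z ∈ triangle) : 0 < halfChord κ z :=
  Real.sqrt_pos.2 (by linarith [(shape_mul_lt_one hκ hκ' hz).2])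

/-- Completing the square in `v`: with `u = 1 - κ v` each fibre is a chord centred at the base
plane, and the hyperball cuts out the proportion `tanhHeight κ` of the half-chord. -/
theorem kappa_mul_quad (hκ : 0 < κ) (hκ' : κ < 2 / 3) (hz : z ∈ triangle) (v : ℝ) :
    κ * quad κ (z 0) (z 1) v = halfChord κ z ^ 2 - (1 - κ * v) ^ 2 := by
  rw [halfChord_sq hκ hκ' hz, quad]
  ring

theorem mem_ballRegion_iff (hκ : 0 < κ) (hκ' : κ < 2 / 3) (hz : z ∈ triangle) {v : ℝ}
    (hv : κ * v ≤ 1) : (1 - κ * v) ^ 2 ≤ (2 / 3 - κ) * quad κ (z 0) (z 1) v ↔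
      ballEnd κ z ≤ v := by
  have h1 := kappa_mul_quad hκ hκ' hz v
  have h2 := tanhHeight_sq hκ'
  have h3 := tanhHeight_pos hκ'
  have h4 := halfChord_pos hκ hκ' hz
  rw [ballEnd, div_le_iff₀ hκ]
  have h5 : (1 - κ * v) ^ 2 ≤ (tanhHeight κ * halfChord κ z) ^ 2 ↔
      1 - v * κ ≤ tanhHeight κ * halfChord κ z := by
    rw [sq_le_sq₀ (by linarith) (by positivity), mul_comm κ]
  rw [sub_le_comm, ← h5, mul_pow, h2]
  constructor <;> intro h <;> nlinarith

theorem le_ballEnd (hκ : 0 < κ) (hκ' : κ < 2 / 3) (hz : z ∈ triangle) :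
    1 + maxCoord z / 2 ≤ ballEnd κ z := by
  have h3 := tanhHeight_pos hκ'
  have h4 := halfChord_pos hκ hκ' hz
  have hv : κ * ballEnd κ z ≤ 1 := by
    rw [ballEnd, mul_div_cancel₀ _ hκ.ne']
    linarith [mul_pos h3 h4]
  exact le_of_mem_ballRegion hκ hκ' (maxCoord_le_one hz) le_shape
    ((mem_ballRegion_iff hκ hκ' hz hv).2 le_rfl)

theorem chartVol_ball (hκ : 0 < κ) (hκ' : κ < 2 / 3) :
    chartVol κ (prism κ ∩ ballRegion κ) = ∫⁻ z in triangle, ∫⁻ v in Icc (ballEnd κ z) (1 / κ),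
      ENNReal.ofReal (1 / quad κ (z 0) (z 1) v ^ 2) := by
  refine chartVol_eq_lintegral κ ((measurableSet_prism κ).inter (measurableSet_ballRegion κ))
    isClosed_triangle.measurableSet (fun _ _ => measurableSet_Icc) fun y => ?_
  rw [mem_inter_iff, mem_prism_iff, and_assoc]
  refine and_congr_right fun hz => ?_
  rw [mem_Icc, le_div_iff₀ hκ, mul_comm (y 0)]
  constructor
  · rintro ⟨⟨h1, h2⟩, h3⟩
    exact ⟨(mem_ballRegion_iff hκ hκ' hz h2).1 h3, h2⟩
  · rintro ⟨h1, h2⟩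
    exact ⟨⟨(le_ballEnd hκ hκ' hz).trans h1, h2⟩, (mem_ballRegion_iff hκ hκ' hz h2).2 h1⟩

theorem chartVol_gap (hκ : 0 < κ) (hκ' : κ < 2 / 3) :
    chartVol κ (prism κ \ ballRegion κ) = ∫⁻ z in triangle,
      ∫⁻ v in Ico (1 + maxCoord z / 2) (ballEnd κ z),
        ENNReal.ofReal (1 / quad κ (z 0) (z 1) v ^ 2) := by
  refine chartVol_eq_lintegral κ ((measurableSet_prism κ).diff (measurableSet_ballRegion κ))
    isClosed_triangle.measurableSet (fun _ _ => measurableSet_Ico) fun y => ?_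
  rw [mem_sdiff, mem_prism_iff, and_assoc]
  refine and_congr_right fun hz => ?_
  rw [mem_Ico]
  constructor
  · rintro ⟨⟨h1, h2⟩, h3⟩
    exact ⟨h1, lt_of_not_ge fun h => h3 ((mem_ballRegion_iff hκ hκ' hz h2).2 h)⟩
  · rintro ⟨h1, h2⟩
    have h3 : κ * y 0 ≤ 1 := by
      have := mul_pos (tanhHeight_pos hκ') (halfChord_pos hκ hκ' hz)
      rw [ballEnd, lt_div_iff₀ hκ] at h2
      linarith
    exact ⟨⟨h1, h3⟩, fun h => h2.not_ge ((mem_ballRegion_iff hκ hκ' hz h3).1 h)⟩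

theorem chartVol_prism (κ : ℝ) : chartVol κ (prism κ) =
    chartVol κ (prism κ ∩ ballRegion κ) + chartVol κ (prism κ \ ballRegion κ) :=
  (lintegral_inter_add_sdiff _ _ (measurableSet_ballRegion κ)).symm

end Fibre

/-! ### The volume of the hyperball part -/

/-- The volume of the hyperball part over a fibre, up to the factor `q⁻³`. -/
def ballFactor (κ : ℝ) : ℝ :=
  tanhHeight κ / 3 + κ / 4 * (2 * Real.log (1 + tanhHeight κ) - Real.log (3 * κ / 2))

/-- The primitive of `1/(q² - u²)²` by partial fractions, where `u = 1 - κ v`. -/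
theorem hasDerivAt_ballPrimitive {κ q v : ℝ} (hq : 0 < q) (hu : 0 ≤ 1 - κ * v)
    (huq : 1 - κ * v < q) :
    HasDerivAt (fun v => -(κ * ((1 - κ * v) / (2 * q ^ 2 * (q ^ 2 - (1 - κ * v) ^ 2)) +
      1 / (4 * q ^ 3) * (Real.log (q + (1 - κ * v)) - Real.log (q - (1 - κ * v))))))
      (κ ^ 2 / (q ^ 2 - (1 - κ * v) ^ 2) ^ 2) v := by
  have hu' : HasDerivAt (fun v : ℝ => 1 - κ * v) (-κ) v := by
    simpa using ((hasDerivAt_id v).const_mul κ).const_sub 1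
  have h1 : q - (1 - κ * v) ≠ 0 := by linarith
  have h2 : q + (1 - κ * v) ≠ 0 := by linarith
  have h3 : q ^ 2 - (1 - κ * v) ^ 2 = (q + (1 - κ * v)) * (q - (1 - κ * v)) := by ring
  have h4 : 2 * q ^ 2 * (q ^ 2 - (1 - κ * v) ^ 2) ≠ 0 := by
    rw [h3]
    positivity
  have hd := (((hu'.div (((hu'.pow 2).const_sub (q ^ 2)).const_mul (2 * q ^ 2)) h4).add
    (((hu'.const_add q).log h2).sub ((hu'.const_sub q).log h1) |>.const_mul
      (1 / (4 * q ^ 3)))).const_mul κ).neg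
  refine hd.congr_deriv ?_
  simp only [Pi.pow_apply, Nat.cast_ofNat, h3]
  generalize 1 - κ * v = u at *
  field_simp
  ring

theorem lintegral_ball_fibre {κ : ℝ} {z : Fin 2 → ℝ} (hκ : 0 < κ) (hκ' : κ < 2 / 3)
    (hz : z ∈ triangle) :
    ∫⁻ v in Icc (ballEnd κ z) (1 / κ), ENNReal.ofReal (1 / quad κ (z 0) (z 1) v ^ 2) =
      ENNReal.ofReal (ballFactor κ / halfChord κ z ^ 3) := by
  have ht := tanhHeight_pos hκ'
  have ht2 := tanhHeight_sq hκ'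
  have hq := halfChord_pos hκ hκ' hz
  have hquad := kappa_mul_quad hκ hκ' hz
  have ht1 : tanhHeight κ < 1 := by nlinarith
  rw [ballFactor]
  have hend : 1 - κ * ballEnd κ z = tanhHeight κ * halfChord κ z := by
    rw [ballEnd]
    field_simp
    ring
  generalize halfChord κ z = q at *
  generalize tanhHeight κ = t at *
  have htq : t * q < q := by nlinarith
  have htq0 : 0 < t * q := mul_pos ht hq
  have hu : ∀ v ∈ Icc (ballEnd κ z) (1 / κ), 0 ≤ 1 - κ * v ∧ 1 - κ * v < q := by
    rintro v ⟨h1, h2⟩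
    rw [le_div_iff₀ hκ] at h2
    have := mul_le_mul_of_nonneg_left h1 hκ.le
    constructor <;> linarith
  have hpos : ∀ v ∈ Icc (ballEnd κ z) (1 / κ), 0 < q ^ 2 - (1 - κ * v) ^ 2 := by
    intro v hv
    obtain ⟨h1, h2⟩ := hu v hv
    nlinarith
  have hcongr : ∀ v ∈ Icc (ballEnd κ z) (1 / κ),
      ENNReal.ofReal (1 / quad κ (z 0) (z 1) v ^ 2) =
        ENNReal.ofReal (κ ^ 2 / (q ^ 2 - (1 - κ * v) ^ 2) ^ 2) := by
    intro v hv
    have h := hpos v hv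
    rw [← hquad] at h ⊢
    have h0 : 0 < quad κ (z 0) (z 1) v := (mul_pos_iff_of_pos_left hκ).1 h
    congr 1
    field_simp
  rw [setLIntegral_congr_fun measurableSet_Icc hcongr, lintegral_Icc_of_hasDerivAt ?_
    (fun v hv => hasDerivAt_ballPrimitive hq (hu v hv).1 (hu v hv).2)]
  · congr 1
    have e1 : 1 - κ * (1 / κ) = 0 := by
      field_simp
      ring
    -- Since `1 - t² = 3κ/2`, the rational term of the primitive loses its factor `κ` and
    -- contributes `t/3`, while the logarithmic term keeps its factor `κ` and a singular logarithm.
    have e2 : q ^ 2 - (t * q) ^ 2 = 3 * κ / 2 * q ^ 2 := by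
      rw [mul_pow, ht2]
      ring
    have e3 : Real.log (q + t * q) - Real.log (q - t * q) =
        2 * Real.log (1 + t) - Real.log (3 * κ / 2) := by
      have e4 : 3 * κ / 2 = (1 - t) * (1 + t) := by linarith
      rw [show q + t * q = q * (1 + t) by ring, show q - t * q = q * (1 - t) by ring, e4,
        Real.log_mul hq.ne' (by linarith), Real.log_mul hq.ne' (by linarith),
        Real.log_mul (by linarith) (by linarith)]
      ring
    rw [e1, hend, e2, e3]
    simp only [add_zero, sub_zero, sub_self, mul_zero, zero_div, neg_zero]
    field_simp
    ring
  · intro v hv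
    apply ContinuousAt.continuousWithinAt
    have := (hpos v hv).ne'
    fun_prop (disch := positivity)
  · intro v hv
    positivity
  · have := hu
    rw [le_div_iff₀ hκ]
    linarith

/-- Uses `t ≥ t² = 1 - 3κ/2` and drops `log(1 + t) ≥ 0`. The surviving term in `-κ log κ` is what
makes the density rise. -/
theorem ballFactor_lower {κ : ℝ} (hκ : 0 < κ) (hκ' : κ < 2 / 3) :
    1 / 3 - κ / 2 + κ / 4 * -Real.log (3 * κ / 2) ≤ ballFactor κ := by
  have ht := tanhHeight_pos hκ'
  have ht2 := tanhHeight_sq hκ'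
  have h1 : 1 - 3 * κ / 2 ≤ tanhHeight κ := by nlinarith
  have h2 : 0 ≤ κ * Real.log (1 + tanhHeight κ) :=
    mul_nonneg hκ.le (Real.log_nonneg (by linarith))
  rw [ballFactor]
  linarith

theorem ballFactor_pos {κ : ℝ} (hκ : 0 < κ) (hκ' : κ < 2 / 3) : 0 < ballFactor κ := by
  have ht := tanhHeight_pos hκ'
  have h1 := Real.log_nonneg (show 1 ≤ 1 + tanhHeight κ by linarith)
  have h2 := Real.log_nonpos (show 0 ≤ 3 * κ / 2 by positivity) (by linarith)
  have h3 : 0 ≤ κ / 4 * (2 * Real.log (1 + tanhHeight κ) - Real.log (3 * κ / 2)) :=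
    mul_nonneg (by positivity) (by linarith)
  rw [ballFactor]
  linarith

theorem tanhHeight_le_halfChord {κ : ℝ} {z : Fin 2 → ℝ} (hκ : 0 < κ) (hκ' : κ < 2 / 3)
    (hz : z ∈ triangle) : tanhHeight κ ≤ halfChord κ z :=
  Real.sqrt_le_sqrt (by linarith [(shape_mul_lt_one hκ hκ' hz).1])

theorem halfChord_le_one {κ : ℝ} {z : Fin 2 → ℝ} (hκ : 0 < κ) : halfChord κ z ≤ 1 := by
  rw [halfChord, Real.sqrt_le_iff, shape]
  have : 0 ≤ κ * (1 + (z 0 ^ 2 + z 1 ^ 2 + (z 0 + z 1) ^ 2) / 3) := by positivity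
  exact ⟨zero_le_one, by linarith⟩

theorem chartVol_ball_bounds {κ : ℝ} (hκ : 0 < κ) (hκ' : κ < 2 / 3) :
    ENNReal.ofReal (ballFactor κ) * volume triangle ≤ chartVol κ (prism κ ∩ ballRegion κ) ∧
    chartVol κ (prism κ ∩ ballRegion κ) ≤
      ENNReal.ofReal (ballFactor κ / tanhHeight κ ^ 3) * volume triangle := by
  have ht := tanhHeight_pos hκ'
  have hN := ballFactor_pos hκ hκ'
  rw [chartVol_ball hκ hκ',
    setLIntegral_congr_fun isClosed_triangle.measurableSet fun z hz => lintegral_ball_fibre hκ hκ' hz,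
    ← setLIntegral_const, ← setLIntegral_const]
  constructor
  · refine setLIntegral_mono' isClosed_triangle.measurableSet fun z hz => ?_
    have hq := halfChord_pos hκ hκ' hz
    refine ENNReal.ofReal_le_ofReal ?_
    rw [le_div_iff₀ (by positivity)]
    exact mul_le_of_le_one_right hN.le (pow_le_one₀ hq.le (halfChord_le_one hκ))
  · refine setLIntegral_mono' isClosed_triangle.measurableSet fun z hz => ?_
    have hq := tanhHeight_le_halfChord hκ hκ' hz
    exact ENNReal.ofReal_le_ofReal (by gcongr)

/-! ### The volume of the gap -/

/-- The limit of the volume of the gap over a fibre. -/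
def gapDensity (z : Fin 2 → ℝ) : ℝ :=
  (1 / (2 * (1 + maxCoord z / 2) - shape (z 0) (z 1)) - 2 / 3) / 2

section Gap

variable {κ : ℝ} {z : Fin 2 → ℝ}

theorem quad_pos_of_mem_gap (hκ : 0 < κ) (hκ' : κ ≤ 1 / 10) (hz : z ∈ triangle) {v : ℝ}
    (hv : v ∈ Icc (1 + maxCoord z / 2) (ballEnd κ z)) : 0 < quad κ (z 0) (z 1) v := by
  have h1 := shape_le hz
  have h3 := maxCoord_nonneg (z := z)
  have h4 := maxCoord_le_one hz
  have h5 : κ * ballEnd κ z ≤ 1 := by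
    have := mul_pos (tanhHeight_pos (by linarith : κ < 2 / 3))
      (halfChord_pos hκ (by linarith) hz)
    rw [ballEnd, mul_div_cancel₀ _ hκ.ne']
    linarith
  obtain ⟨hv1, hv2⟩ := hv
  have h6 : κ * v ≤ 1 := (mul_le_mul_of_nonneg_left hv2 hκ.le).trans h5
  rw [quad]
  nlinarith

/-- The factor `1 - κ v` is half the derivative of `quad` in `v`, so weighting by it makes the fibre
integral elementary. -/
theorem hasDerivAt_gapPrimitive {v : ℝ} (h : quad κ (z 0) (z 1) v ≠ 0) :
    HasDerivAt (fun v => -(1 / 2 * (quad κ (z 0) (z 1) v)⁻¹))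
      ((1 - κ * v) / quad κ (z 0) (z 1) v ^ 2) v := by
  have hd : HasDerivAt (fun v => quad κ (z 0) (z 1) v) (2 * 1 - κ * (2 * v)) v := by
    have h := ((hasDerivAt_id' v).const_mul 2).sub ((hasDerivAt_pow 2 v).const_mul κ)
    refine (h.sub_const (shape (z 0) (z 1))).congr_deriv ?_
    norm_num
  refine ((hd.inv h).const_mul (1 / 2)).neg.congr_deriv ?_
  field_simp

/-- The exact integral that approximates the volume of the gap over a fibre. -/
def gapApprox (κ : ℝ) (z : Fin 2 → ℝ) : ℝ :=
  (1 / (2 * (1 + maxCoord z / 2) - κ * (1 + maxCoord z / 2) ^ 2 - shape (z 0) (z 1)) -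
    2 / (3 * (1 - κ * shape (z 0) (z 1)))) / 2

theorem lintegral_gapApprox (hκ : 0 < κ) (hκ' : κ ≤ 1 / 10) (hz : z ∈ triangle) :
    ∫⁻ v in Ico (1 + maxCoord z / 2) (ballEnd κ z),
      ENNReal.ofReal ((1 - κ * v) / quad κ (z 0) (z 1) v ^ 2) = ENNReal.ofReal (gapApprox κ z) := by
  have hκ2 : κ < 2 / 3 := by linarith
  have ht := tanhHeight_pos hκ2
  have hq := halfChord_pos hκ hκ2 hz
  have hq2 := halfChord_sq hκ hκ2 hz
  have hpos := fun v hv => quad_pos_of_mem_gap hκ hκ' hz (v := v) hv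
  have hend : 1 - κ * ballEnd κ z = tanhHeight κ * halfChord κ z := by
    rw [ballEnd]
    field_simp
    ring
  rw [Measure.restrict_congr_set Ico_ae_eq_Icc, lintegral_Icc_of_hasDerivAt (le_ballEnd hκ hκ2 hz)
    (fun v hv => hasDerivAt_gapPrimitive (hpos v hv).ne')]
  · congr 1
    -- At the boundary of the ball, `κ · quad = q²(1 - t²) = 3κ q²/2`; this produces the constant
    -- `2/3` in the limit of the gap.
    have e : quad κ (z 0) (z 1) (ballEnd κ z) = 3 * (1 - κ * shape (z 0) (z 1)) / 2 := by
      have := kappa_mul_quad hκ hκ2 hz (ballEnd κ z)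
      rw [hend, mul_pow, tanhHeight_sq hκ2, hq2] at this
      apply mul_left_cancel₀ hκ.ne'
      rw [this]
      ring
    rw [e, gapApprox, quad, inv_div]
    ring
  · intro v hv
    apply ContinuousAt.continuousWithinAt
    have := (hpos v hv).ne'
    have hc : ContinuousAt (fun v => quad κ (z 0) (z 1) v) v := by
      unfold quad
      fun_prop
    exact ContinuousAt.div (by fun_prop) (hc.pow 2) (pow_ne_zero 2 this)
  · intro v hv
    have := mul_le_mul_of_nonneg_left hv.2 hκ.le
    exact div_nonneg (by nlinarith) (sq_nonneg _)

/-- On the gap the weight `1 - κ v` lies between `1 - 3κ` and `1`, because `κ v ≤ 1 - tq` and `tq ≥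
t² = 1 - 3κ/2`. Inserting it therefore costs only a factor `1 + O(κ)`. -/
theorem gap_fibre_bounds (hκ : 0 < κ) (hκ' : κ ≤ 1 / 10) (hz : z ∈ triangle) :
    ENNReal.ofReal (gapApprox κ z) ≤ ∫⁻ v in Ico (1 + maxCoord z / 2) (ballEnd κ z),
        ENNReal.ofReal (1 / quad κ (z 0) (z 1) v ^ 2) ∧
    ∫⁻ v in Ico (1 + maxCoord z / 2) (ballEnd κ z),
        ENNReal.ofReal (1 / quad κ (z 0) (z 1) v ^ 2) ≤
      ENNReal.ofReal (1 / (1 - 3 * κ)) * ENNReal.ofReal (gapApprox κ z) := by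
  have hκ2 : κ < 2 / 3 := by linarith
  have h3 := maxCoord_nonneg (z := z)
  rw [← lintegral_gapApprox hκ hκ' hz]
  constructor
  · refine setLIntegral_mono' measurableSet_Ico fun v hv => ENNReal.ofReal_le_ofReal ?_
    have hv0 : 0 ≤ κ * v := mul_nonneg hκ.le (by linarith [hv.1])
    gcongr
    linarith
  · rw [← lintegral_const_mul' _ _ ENNReal.ofReal_ne_top]
    refine setLIntegral_mono' measurableSet_Ico fun v hv => ?_
    have hs : 0 < 1 - 3 * κ := by linarith
    rw [← ENNReal.ofReal_mul (by positivity)]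
    refine ENNReal.ofReal_le_ofReal ?_
    have h1 : 1 - 3 * κ ≤ 1 - κ * v := by
      have h2 := mul_le_mul_of_nonneg_left hv.2.le hκ.le
      have ht := tanhHeight_pos hκ2
      have hq := halfChord_pos hκ hκ2 hz
      have hq1 := halfChord_le_one (z := z) hκ
      have ht2 := tanhHeight_sq hκ2
      have htq := tanhHeight_le_halfChord hκ hκ2 hz
      rw [ballEnd, mul_div_cancel₀ _ hκ.ne'] at h2
      nlinarith
    rw [div_mul_div_comm, one_mul, ← div_div]
    exact div_le_div_of_nonneg_right ((one_le_div hs).2 h1) (sq_nonneg _)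

theorem gapApprox_bounds (hκ : 0 < κ) (hκ' : κ ≤ 1 / 10) (hz : z ∈ triangle) :
    gapDensity z ≤ gapApprox κ z + κ ∧ gapApprox κ z ≤ gapDensity z + 2 * κ := by
  have h1 := shape_le hz
  have h2 := le_shape (z := z)
  have h3 := maxCoord_nonneg (z := z)
  have h4 := maxCoord_le_one hz
  rw [gapDensity, gapApprox]
  set y := 2 * (1 + maxCoord z / 2) - shape (z 0) (z 1) with hy
  set D := shape (z 0) (z 1) with hD
  set L := 1 + maxCoord z / 2 with hL
  have hy1 : 1 ≤ y := by linarith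
  have hD1 : 1 ≤ D := by nlinarith
  have hD2 : D ≤ 3 / 2 := by linarith
  have hL2 : L ^ 2 ≤ 9 / 4 := by nlinarith
  have hx : κ * L ^ 2 ≤ 9 / 4 * κ := by nlinarith
  have hx0 : 0 ≤ κ * L ^ 2 := by positivity
  have hκD : κ * D ≤ 3 / 2 * κ := by nlinarith
  have hκD0 : 0 ≤ κ * D := by positivity
  rw [show 2 * L - κ * L ^ 2 - D = y - κ * L ^ 2 by rw [hy]; ring]
  have a1 : 1 / y ≤ 1 / (y - κ * L ^ 2) :=
    one_div_le_one_div_of_le (by linarith) (by linarith)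
  have a2 : 1 / (y - κ * L ^ 2) ≤ 1 / y + 4 * κ := by
    have hp : 0 < y - κ * L ^ 2 := by linarith
    have e : 1 / (y - κ * L ^ 2) - 1 / y = κ * L ^ 2 / (y * (y - κ * L ^ 2)) := by
      field_simp
      ring
    have : κ * L ^ 2 / (y * (y - κ * L ^ 2)) ≤ 4 * κ := by
      rw [div_le_iff₀ (by positivity)]
      have h7 : 3 / 4 ≤ y * (y - κ * L ^ 2) := by nlinarith
      nlinarith
    linarith
  have b1 : 2 / 3 ≤ 2 / (3 * (1 - κ * D)) := by
    rw [div_le_div_iff₀ (by norm_num) (by linarith)]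
    linarith
  have b2 : 2 / (3 * (1 - κ * D)) ≤ 2 / 3 + 2 * κ := by
    rw [div_le_iff₀ (by linarith)]
    nlinarith
  constructor <;> linarith

end Gap

/-- The limit of the volume of the gap. -/
def gapLimit : ENNReal := ∫⁻ z in triangle, ENNReal.ofReal (gapDensity z)

theorem chartVol_gap_bounds {κ : ℝ} (hκ : 0 < κ) (hκ' : κ ≤ 1 / 10) :
    gapLimit ≤ chartVol κ (prism κ \ ballRegion κ) + ENNReal.ofReal κ * volume triangle ∧
    chartVol κ (prism κ \ ballRegion κ) ≤
      ENNReal.ofReal (1 / (1 - 3 * κ)) * (gapLimit + ENNReal.ofReal (2 * κ) * volume triangle) := by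
  have hT := isClosed_triangle.measurableSet
  rw [chartVol_gap hκ (by linarith), gapLimit, ← setLIntegral_const, ← setLIntegral_const]
  constructor
  · rw [← lintegral_add_right _ measurable_const]
    refine setLIntegral_mono' hT fun z hz => ?_
    calc ENNReal.ofReal (gapDensity z)
        ≤ ENNReal.ofReal (gapApprox κ z + κ) :=
          ENNReal.ofReal_le_ofReal (gapApprox_bounds hκ hκ' hz).1
      _ ≤ ENNReal.ofReal (gapApprox κ z) + ENNReal.ofReal κ := ENNReal.ofReal_add_le
      _ ≤ _ := by
        gcongr
        exact (gap_fibre_bounds hκ hκ' hz).1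
  · rw [← lintegral_add_right _ measurable_const,
      ← lintegral_const_mul' _ _ ENNReal.ofReal_ne_top]
    refine setLIntegral_mono' hT fun z hz => (gap_fibre_bounds hκ hκ' hz).2.trans ?_
    gcongr
    exact (ENNReal.ofReal_le_ofReal (gapApprox_bounds hκ hκ' hz).2).trans ENNReal.ofReal_add_le

theorem gapLimit_lt_top : gapLimit < ⊤ := by
  refine (setLIntegral_mono' isClosed_triangle.measurableSet
    (g := fun _ => ENNReal.ofReal 1) fun z hz => ENNReal.ofReal_le_ofReal ?_).trans_lt ?_
  · have h1 := shape_le hz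
    have h3 := maxCoord_nonneg (z := z)
    have : 1 / (2 * (1 + maxCoord z / 2) - shape (z 0) (z 1)) ≤ 1 := by
      rw [div_le_one (by linarith)]
      linarith
    rw [gapDensity]
    linarith
  · rw [setLIntegral_const]
    exact ENNReal.mul_lt_top ENNReal.ofReal_lt_top volume_triangle_lt_top

theorem gapLimit_pos : 0 < gapLimit := by
  -- Near the centre `m ≤ 1/2`, so the denominator is at most `1 + m - m²/2 ≤ 11/8 < 10/7`; then
  -- `1/60 = (7/10 - 2/3)/2`.
  have h : ∀ z ∈ Icc (fun _ : Fin 2 => (-1 / 4 : ℝ)) (fun _ => 1 / 4), 1 / 60 ≤ gapDensity z := by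
    intro z hz
    have h2 := le_shape (z := z)
    have h1 := shape_le (square_subset_triangle hz)
    have h3 := maxCoord_nonneg (z := z)
    obtain ⟨hz1, hz2⟩ := hz
    have a0 := hz1 0
    have a1 := hz1 1
    have b0 := hz2 0
    have b1 := hz2 1
    simp only at a0 a1 b0 b1
    have h4 : maxCoord z ≤ 1 / 2 := maxCoord_le_iff.2 ⟨by linarith, by linarith, by linarith⟩
    have h5 : 7 / 10 ≤ 1 / (2 * (1 + maxCoord z / 2) - shape (z 0) (z 1)) := by
      rw [le_div_iff₀ (by linarith)]
      nlinarith
    rw [gapDensity]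
    linarith
  calc 0 < ENNReal.ofReal (1 / 60) * volume (Icc (fun _ : Fin 2 => (-1 / 4 : ℝ)) fun _ => 1 / 4) :=
        ENNReal.mul_pos (ENNReal.ofReal_pos.2 (by norm_num)).ne' volume_square_pos.ne'
    _ = ∫⁻ _ in Icc (fun _ : Fin 2 => (-1 / 4 : ℝ)) (fun _ => 1 / 4), ENNReal.ofReal (1 / 60) :=
        (setLIntegral_const _ _).symm
    _ ≤ ∫⁻ z in Icc (fun _ : Fin 2 => (-1 / 4 : ℝ)) (fun _ => 1 / 4),
          ENNReal.ofReal (gapDensity z) :=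
        setLIntegral_mono' measurableSet_Icc fun z hz => ENNReal.ofReal_le_ofReal (h z hz)
    _ ≤ gapLimit := lintegral_mono_set square_subset_triangle

/-! ### Behaviour of the density near `κ = 0` -/

theorem toReal_chartVol_ball_bounds {κ : ℝ} (hκ : 0 < κ) (hκ' : κ < 2 / 3) :
    ballFactor κ * (volume triangle).toReal ≤ (chartVol κ (prism κ ∩ ballRegion κ)).toReal ∧
    (chartVol κ (prism κ ∩ ballRegion κ)).toReal ≤
      ballFactor κ / tanhHeight κ ^ 3 * (volume triangle).toReal := by
  obtain ⟨h1, h2⟩ := chartVol_ball_bounds hκ hκ'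
  have hN := ballFactor_pos hκ hκ'
  have ht := tanhHeight_pos hκ'
  have hfin : ENNReal.ofReal (ballFactor κ / tanhHeight κ ^ 3) * volume triangle ≠ ⊤ :=
    ENNReal.mul_ne_top ENNReal.ofReal_ne_top volume_triangle_lt_top.ne
  have h3 := ENNReal.toReal_mono (h2.trans_lt hfin.lt_top).ne h1
  have h4 := ENNReal.toReal_mono hfin h2
  rw [ENNReal.toReal_mul, ENNReal.toReal_ofReal (by positivity)] at h3 h4
  exact ⟨h3, h4⟩

theorem chartVol_gap_ne_top {κ : ℝ} (hκ : 0 < κ) (hκ' : κ ≤ 1 / 10) :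
    chartVol κ (prism κ \ ballRegion κ) ≠ ⊤ := by
  refine ((chartVol_gap_bounds hκ hκ').2.trans_lt (ENNReal.mul_lt_top ENNReal.ofReal_lt_top
    (ENNReal.add_lt_top.2 ⟨gapLimit_lt_top, ?_⟩))).ne
  exact ENNReal.mul_lt_top ENNReal.ofReal_lt_top volume_triangle_lt_top

theorem toReal_chartVol_gap_bounds {κ : ℝ} (hκ : 0 < κ) (hκ' : κ ≤ 1 / 10) :
    gapLimit.toReal - κ * (volume triangle).toReal ≤
      (chartVol κ (prism κ \ ballRegion κ)).toReal ∧
    (chartVol κ (prism κ \ ballRegion κ)).toReal ≤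
      1 / (1 - 3 * κ) * (gapLimit.toReal + 2 * κ * (volume triangle).toReal) := by
  obtain ⟨h1, h2⟩ := chartVol_gap_bounds hκ hκ'
  have hs : 0 < 1 - 3 * κ := by linarith
  have hg := chartVol_gap_ne_top hκ hκ'
  have hA : ∀ c, ENNReal.ofReal c * volume triangle ≠ ⊤ := fun c =>
    ENNReal.mul_ne_top ENNReal.ofReal_ne_top volume_triangle_lt_top.ne
  have h3 := ENNReal.toReal_mono (ENNReal.add_ne_top.2 ⟨hg, hA κ⟩) h1
  have h4 := ENNReal.toReal_mono (ENNReal.mul_ne_top ENNReal.ofReal_ne_top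
    (ENNReal.add_ne_top.2 ⟨gapLimit_lt_top.ne, hA _⟩)) h2
  rw [ENNReal.toReal_add hg (hA κ), ENNReal.toReal_mul, ENNReal.toReal_ofReal hκ.le] at h3
  rw [ENNReal.toReal_mul, ENNReal.toReal_add gapLimit_lt_top.ne (hA _), ENNReal.toReal_mul,
    ENNReal.toReal_ofReal (by positivity), ENNReal.toReal_ofReal (by positivity)] at h4
  exact ⟨by linarith, h4⟩

/-- Only `κ log κ` needs care; it is continuous at `0` because `x log x` is, with the convention
`log 0 = 0`. -/
theorem tendsto_ballFactor_div :
    Filter.Tendsto (fun κ => ballFactor κ / tanhHeight κ ^ 3) (nhdsWithin 0 (Ioi 0))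
      (nhds (1 / 3)) := by
  have ht : Continuous tanhHeight := by
    unfold tanhHeight
    fun_prop
  have ht0 : tanhHeight 0 = 1 := by simp [tanhHeight]
  have hmul : Continuous fun κ : ℝ => 3 * κ / 2 * Real.log (3 * κ / 2) :=
    Real.continuous_mul_log.comp (by fun_prop)
  have hN : ContinuousAt ballFactor 0 := by
    have e : ballFactor = fun κ => tanhHeight κ / 3 + κ / 2 * Real.log (1 + tanhHeight κ) -
        1 / 6 * (3 * κ / 2 * Real.log (3 * κ / 2)) := by
      ext κ
      rw [ballFactor]
      ring
    have hl : ContinuousAt (fun κ => Real.log (1 + tanhHeight κ)) 0 :=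
      (continuous_const.add ht).continuousAt.log (by simp [ht0])
    rw [e]
    exact ((ht.continuousAt.div_const 3).add
      ((continuousAt_id.div_const 2).mul hl)).sub (hmul.continuousAt.const_mul _)
  have h : ContinuousAt (fun κ => ballFactor κ / tanhHeight κ ^ 3) 0 :=
    hN.div (ht.continuousAt.pow 3) (by rw [ht0]; norm_num)
  have h0 : ballFactor 0 / tanhHeight 0 ^ 3 = 1 / 3 := by simp [ballFactor, ht0]
  rw [← h0]
  exact h.tendsto.mono_left nhdsWithin_le_nhds

/-- The density in terms of the parameter `κ`. -/
def kappaDensity (κ : ℝ) : ℝ :=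
  (chartVol κ (prism κ ∩ ballRegion κ)).toReal / (chartVol κ (prism κ)).toReal

theorem volume_triangle_toReal_pos : 0 < (volume triangle).toReal :=
  ENNReal.toReal_pos volume_triangle_pos.ne' volume_triangle_lt_top.ne

theorem chartVol_ball_toReal_pos {κ : ℝ} (hκ : 0 < κ) (hκ' : κ < 2 / 3) :
    0 < (chartVol κ (prism κ ∩ ballRegion κ)).toReal :=
  (mul_pos (ballFactor_pos hκ hκ') volume_triangle_toReal_pos).trans_le
    (toReal_chartVol_ball_bounds hκ hκ').1

/-! ### Comparison with the limit at `κ = 0` and the contradiction -/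

theorem mul_le_mul_of_kappaDensity_le {κ κ' : ℝ} (hκ : 0 < κ) (hκ10 : κ ≤ 1 / 10) (hκ' : 0 < κ')
    (hκ10' : κ' ≤ 1 / 10) (h : kappaDensity κ ≤ kappaDensity κ') :
    (chartVol κ (prism κ ∩ ballRegion κ)).toReal *
        (chartVol κ' (prism κ' \ ballRegion κ')).toReal ≤
      (chartVol κ' (prism κ' ∩ ballRegion κ')).toReal *
        (chartVol κ (prism κ \ ballRegion κ)).toReal := by
  have hfin : ∀ x : ℝ, 0 < x → x ≤ 1 / 10 → (chartVol x (prism x)).toReal =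
      (chartVol x (prism x ∩ ballRegion x)).toReal +
        (chartVol x (prism x \ ballRegion x)).toReal := by
    intro x hx hx'
    rw [chartVol_prism, ENNReal.toReal_add _ (chartVol_gap_ne_top hx hx')]
    exact (ENNReal.toReal_pos_iff.1 (chartVol_ball_toReal_pos hx (by linarith))).2.ne
  have h1 := chartVol_ball_toReal_pos hκ (by linarith)
  have h2 := chartVol_ball_toReal_pos hκ' (by linarith)
  have h3 : 0 ≤ (chartVol κ (prism κ \ ballRegion κ)).toReal := ENNReal.toReal_nonneg
  have h4 : 0 ≤ (chartVol κ' (prism κ' \ ballRegion κ')).toReal := ENNReal.toReal_nonneg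
  rw [kappaDensity, kappaDensity, hfin κ hκ hκ10, hfin κ' hκ' hκ10',
    div_le_div_iff₀ (by linarith) (by linarith)] at h
  linarith

/-- Keep `κ` fixed and let `κ' → 0` in the cross-multiplied comparison of the ball-to-gap ratios.
The lower bound for the gap and the upper bound for the ball both converge. -/
theorem limit_le_of_kappaDensity_le {κ : ℝ} (hκ : 0 < κ) (hκ10 : κ ≤ 1 / 10)
    (h : ∀ κ', 0 < κ' → κ' < κ → kappaDensity κ ≤ kappaDensity κ') :
    (chartVol κ (prism κ ∩ ballRegion κ)).toReal * gapLimit.toReal ≤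
      1 / 3 * (volume triangle).toReal * (chartVol κ (prism κ \ ballRegion κ)).toReal := by
  set A := (volume triangle).toReal
  set n := (chartVol κ (prism κ ∩ ballRegion κ)).toReal
  set g := (chartVol κ (prism κ \ ballRegion κ)).toReal
  have hleft : Filter.Tendsto (fun κ' => n * (gapLimit.toReal - κ' * A)) (nhdsWithin 0 (Ioi 0))
      (nhds (n * (gapLimit.toReal - 0 * A))) := by
    refine Filter.Tendsto.mono_left (Continuous.tendsto ?_ 0) nhdsWithin_le_nhds
    fun_prop
  have hright := (tendsto_ballFactor_div.mul_const A).mul_const g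
  rw [zero_mul, sub_zero] at hleft
  refine le_of_tendsto_of_tendsto hleft hright ?_
  filter_upwards [Ioo_mem_nhdsGT hκ] with κ' hκ'
  obtain ⟨h0, h1⟩ := hκ'
  have h10 : κ' ≤ 1 / 10 := by linarith
  calc n * (gapLimit.toReal - κ' * A)
      ≤ n * (chartVol κ' (prism κ' \ ballRegion κ')).toReal :=
        mul_le_mul_of_nonneg_left (toReal_chartVol_gap_bounds h0 h10).1 ENNReal.toReal_nonneg
    _ ≤ (chartVol κ' (prism κ' ∩ ballRegion κ')).toReal * g :=
        mul_le_mul_of_kappaDensity_le hκ hκ10 h0 h10 (h κ' h0 h1)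
    _ ≤ _ := mul_le_mul_of_nonneg_right (toReal_chartVol_ball_bounds h0 (by linarith)).2
        ENNReal.toReal_nonneg

theorem exists_kappaDensity_lt : ∃ κ κ' : ℝ, 0 < κ' ∧ κ' < κ ∧ κ < 2 / 3 ∧
    kappaDensity κ' < kappaDensity κ := by
  by_contra! hcon
  set A := (volume triangle).toReal with hA
  set G := gapLimit.toReal with hG
  have hApos : 0 < A := volume_triangle_toReal_pos
  have hGpos : 0 < G := ENNReal.toReal_pos gapLimit_pos.ne' gapLimit_lt_top.ne
  -- With `κ = (2/3) e^{-M}` the logarithm is exactly `M`, and comparing the terms of order `κ`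
  -- gives `MG/4 ≤ (13/6)G + A`. The chosen `M` makes the left side `(9/4)G + A`, which is larger;
  -- `M > 9` also forces `κ ≤ 1/10`.
  set M := 9 + 4 * (A / G) with hM
  have hMpos : 9 < M := by
    have : 0 < A / G := by positivity
    linarith
  set κ := 2 / 3 * Real.exp (-M) with hκdef
  have hκ : 0 < κ := by positivity
  have hκ10 : κ ≤ 1 / 10 := by
    have h1 : Real.exp (-M) * (M + 1) ≤ 1 := by
      calc Real.exp (-M) * (M + 1) ≤ Real.exp (-M) * Real.exp M :=
            mul_le_mul_of_nonneg_left (Real.add_one_le_exp M) (Real.exp_pos _).le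
        _ = 1 := by rw [← Real.exp_add, neg_add_cancel, Real.exp_zero]
    have h2 : Real.exp (-M) * 10 ≤ Real.exp (-M) * (M + 1) :=
      mul_le_mul_of_nonneg_left (by linarith) (Real.exp_pos _).le
    linarith
  have hlog : -Real.log (3 * κ / 2) = M := by
    rw [hκdef, show 3 * (2 / 3 * Real.exp (-M)) / 2 = Real.exp (-M) by ring, Real.log_exp, neg_neg]
  have h1 := limit_le_of_kappaDensity_le hκ hκ10 fun κ' h0 h1 => hcon κ κ' h0 h1 (by linarith)
  have h2 := (toReal_chartVol_ball_bounds hκ (by linarith)).1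
  have h3 := (toReal_chartVol_gap_bounds hκ hκ10).2
  have h4 := ballFactor_lower hκ (by linarith)
  rw [hlog] at h4
  rw [← hA, ← hG] at *
  have h5 : ballFactor κ * A * G ≤
      1 / 3 * A * (1 / (1 - 3 * κ) * (G + 2 * κ * A)) :=
    (mul_le_mul_of_nonneg_right h2 hGpos.le).trans
      (h1.trans (mul_le_mul_of_nonneg_left h3 (by positivity)))
  have h6 : 1 / (1 - 3 * κ) ≤ 1 + 5 * κ := by
    rw [div_le_iff₀ (by linarith)]
    nlinarith
  have h7 : 1 / (1 - 3 * κ) * (G + 2 * κ * A) ≤ G + κ * (5 * G + 3 * A) := by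
    have h8 : (1 + 5 * κ) * (2 * κ * A) ≤ κ * (3 * A) := by
      have : 0 ≤ κ * A * (1 / 10 - κ) := mul_nonneg (by positivity) (by linarith)
      nlinarith
    have h9 := mul_le_mul_of_nonneg_right h6 (show 0 ≤ G + 2 * κ * A by positivity)
    linarith
  have h8 : ballFactor κ * G ≤ 1 / 3 * (G + κ * (5 * G + 3 * A)) := by
    refine le_of_mul_le_mul_left ?_ hApos
    have := mul_le_mul_of_nonneg_left h7 (show 0 ≤ 1 / 3 * A by positivity)
    linarith
  have h9 := (mul_le_mul_of_nonneg_right h4 hGpos.le).trans h8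
  have h10 : M * G = 9 * G + 4 * A := by
    rw [hM]
    field_simp
  have h11 : κ * (M * G / 4) ≤ κ * (G / 2 + 5 / 3 * G + A) := by linarith
  have h12 := le_of_mul_le_mul_left h11 hκ
  linarith

/-! ### Conclusion -/

theorem kappa_surjective {κ : ℝ} (hκ : 0 < κ) (hκ' : κ < 2 / 3) :
    ∃ p : ℝ, 6 < p ∧ kappa (scale p) = κ := by
  have hd : 0 < 8 - 9 * κ := by linarith
  -- The cosine of the dihedral angle, obtained by solving `κ = 1 - (1 + c)/(3(3c - 1))` for `c`. It
  -- lies strictly between `1/2` and `1`.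
  set c := (4 - 3 * κ) / (8 - 9 * κ) with hc
  have hc1 : c < 1 := by
    rw [hc, div_lt_one hd]
    linarith
  have hc2 : 1 / 2 < c := by
    rw [hc, lt_div_iff₀ hd]
    linarith
  have hθ : 0 < Real.arccos c := Real.arccos_pos.2 hc1
  have hθ' : Real.arccos c < Real.pi / 3 := by
    rw [← Real.arccos_cos (x := Real.pi / 3) (by positivity) (by linarith [Real.pi_pos]),
      Real.cos_pi_div_three]
    exact Real.arccos_lt_arccos (by norm_num) hc2 hc1.le
  have hp : 6 < 2 * Real.pi / Real.arccos c := by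
    rw [lt_div_iff₀ hθ]
    linarith
  refine ⟨2 * Real.pi / Real.arccos c, hp, ?_⟩
  have hpi := Real.pi_pos.ne'
  rw [kappa, scale_sq hp, div_div_cancel₀ (by positivity), Real.cos_arccos (by linarith) hc1.le, hc]
  have h1 : 1 + (4 - 3 * κ) / (8 - 9 * κ) = 12 * (1 - κ) / (8 - 9 * κ) := by
    rw [one_add_div hd.ne']
    ring
  have h2 : 3 * ((4 - 3 * κ) / (8 - 9 * κ)) - 1 = 4 / (8 - 9 * κ) := by
    rw [← mul_div_assoc, div_sub_one hd.ne']
    ring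
  rw [h1, h2]
  field_simp
  ring

theorem density_eq_of_height_eq {p q : ℝ} (hp : 6 < p) (hq : 6 < q) (h : height p = height q) :
    density p = density q := by
  have h1 : ¬ scale q < scale p := fun h' => ((height_lt_height_iff hp hq).2 h').ne h
  have h2 : ¬ scale p < scale q := fun h' => ((height_lt_height_iff hq hp).2 h').ne h.symm
  rw [density_eq_chartVol hp, density_eq_chartVol hq, le_antisymm (not_lt.1 h1) (not_lt.1 h2)]

theorem exists_height_lt_density_lt : ∃ p q : ℝ, 6 < p ∧ 6 < q ∧ height p < height q ∧
    density q < density p := by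
  obtain ⟨κ, κ', h0, h1, h2, h3⟩ := exists_kappaDensity_lt
  obtain ⟨p, hp, rfl⟩ := kappa_surjective (h0.trans h1) h2
  obtain ⟨q, hq, rfl⟩ := kappa_surjective h0 (h1.trans h2)
  refine ⟨p, q, hp, hq, ?_, ?_⟩
  · rw [height_lt_height_iff hp hq]
    have hsp := (scale_bounds hp).1
    have hsq := (scale_bounds hq).1
    rw [kappa, kappa, sub_lt_sub_iff_left, one_div_lt_one_div (by positivity) (by positivity),
      mul_lt_mul_iff_right₀ three_pos] at h1
    exact lt_of_pow_lt_pow_left₀ 2 hsp.le h1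
  · rw [density_eq_chartVol hp, density_eq_chartVol hq]
    exact h3

end HyperballPacking

end

/-- The density `δ(S(p))`, `p ∈ (6, ∞)`, depends only on the height `h(p)`, and as a function of
the height it is not increasing (not even in the weak sense). -/
theorem corollary2p10 :
    ∃ D : ℝ → ℝ,
      (∀ p : ℝ, 6 < p → D (HyperballPacking.height p) = HyperballPacking.density p) ∧
      ¬ MonotoneOn D (HyperballPacking.height '' Set.Ioi 6) := by
  -- The function `D` evaluates the density at some parameter of the given height;
  -- `density_eq_of_height_eq` makes the choice irrelevant.
  have hD : ∀ p : ℝ, 6 < p → HyperballPacking.density (Function.invFunOn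
      HyperballPacking.height (Set.Ioi 6) (HyperballPacking.height p)) =
        HyperballPacking.density p := by
    intro p hp
    have h : ∃ q ∈ Set.Ioi (6 : ℝ), HyperballPacking.height q = HyperballPacking.height p :=
      ⟨p, hp, rfl⟩
    exact HyperballPacking.density_eq_of_height_eq (Function.invFunOn_mem h) hp
      (Function.invFunOn_eq h)
  refine ⟨fun r => HyperballPacking.density
    (Function.invFunOn HyperballPacking.height (Set.Ioi 6) r), hD, fun hmono => ?_⟩
  obtain ⟨p, q, hp, hq, h1, h2⟩ := HyperballPacking.exists_height_lt_density_lt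
  have h := hmono ⟨p, hp, rfl⟩ ⟨q, hq, rfl⟩ h1.le
  simp only [hD p hp, hD q hq] at h
  exact h2.not_ge h
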